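/- Write $I=[0,1]$, and for a map $f$ on $I^2$ write $d^0_1f=f(0,-)$ and $d^0_2f=f(-,0)$ for its restrictions to $\partial^0_1=\{0\}\times I$ and $\partial^0_2=I\times\{0\}$. A *left cubical ball of dimension 2* is a finite regular CW complex $B$ homeomorphic to the closed $2$-disk, with a vertex $0$ in its interior and closed $2$-cells $B_i$ ($i$ in a finite index set), $B=\bigcup_i B_i$, each equipped with a homeomorphism $h_i\colon I^2\to B_i$ that carries the open faces of $I^2$ (vertices, open edges, open square) to open cells of $B$, such that $h_i(0,0)=0$; $h_i(x,y)\in\partial B$ if and only if $x=1$ or $y=1$; and the parametrizations $d^0_sh_i$, $d^0_th_j$ of a common edge $\partial^0_sB_i=\partial^0_tB_j$ coincide. Two such balls are *equivalent* if there is a homeomorphism between them preserving $0$ and carrying $2$-cells to $2$-cells, where the parametrizations $h_i$ correspond up to swapping the two coordinates of $I^2$. An *orientation* of $B$ is a choice of signs $\epsilon_i=\pm1$ of the $2$-cells for which $\sum\epsilon_iB_i$ is a relative fundamental cycle: if $\partial^0_sB_i=\partial^0_tB_j$ with $(i,s)\ne(j,t)$, then $\epsilon_i(-1)^s=-\epsilon_j(-1)^t$.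 For $k\ge 2$ let $C_k=B_1\cup\dots\cup B_k$ be obtained from $k$ squares by gluing, for each $i$ modulo $k$, the edge $\partial^0_2B_i$ to $\partial^0_1B_{i+1}$ via $(t,0)\sim(0,t)$. Let $(X,x_0)$ be a pointed space. A *left path* is a path $a$ in $X$ with $a(1)=x_0$. A *left 2-track* is a homotopy class rel $\partial I^2$ of maps $\alpha\colon I^2\to X$ with $\alpha(1,t)=\alpha(t,1)=x_0$ for all $t$; it is a morphism $\alpha\colon d^0_1\alpha\Rightarrow d^0_2\alpha$ between left paths, with inverse $\alpha^{-1}$ represented by $(x,y)\mapsto\alpha(y,x)$. An (oriented) *left 2-cubical ball* in $X$ is a left cubical ball $B$ of dimension 2 with an orientation $(\epsilon_i)$ and a left 2-track $\alpha_i$ for each $2$-cell $B_i$, such that $d^0_s\alpha_i=d^0_t\alpha_j$ whenever $\partial^0_sB_i=\partial^0_tB_j$. Two of them are identified if there is a homeomorphism between the underlying balls preserving $0$, the parametrized $2$-cells, the signs and the tracks. **Proposition.** 1. For every $k\ge2$, $C_k$ is a left cubical ball of dimension 2 whose only coincidences among the edges $\partial^0_sB_i$ are $e_i:=\partial^0_2B_i=\partial^0_1B_{i+1}$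 ($i$ modulo $k$). Every left cubical ball of dimension 2 is equivalent to $C_k$ for some $k\ge2$. It has an orientation, unique up to a global sign. 2. Left 2-cubical balls in a pointed space $X$ correspond to circular chains of $k\ge 2$ composable left 2-tracks with signs $$a_0\xRightarrow{\alpha_1^{\epsilon_1}}a_1\xRightarrow{\alpha_2^{\epsilon_2}}\cdots\Rightarrow a_{k-1}\xRightarrow{\alpha_k^{\epsilon_k}}a_k=a_0 .$$ Precisely, say that such a chain *expresses* a left 2-cubical ball if the $2$-cells of the ball can be listed, each once, as $B_1,\dots,B_k$ with signs $\epsilon_i$ and tracks $\alpha_i$ so that, for $i$ modulo $k$, the edge of $B_i$ carrying the target of $\alpha_i^{\epsilon_i}$ is the edge of $B_{i+1}$ carrying the source of $\alpha_{i+1}^{\epsilon_{i+1}}$. Then every left 2-cubical ball in $X$ is expressed by some circular chain, and every circular chain expresses some left 2-cubical ball. If a chain expresses a given ball, then the chains expressing this ball are exactly its cyclic permutations, and the left 2-cubical balls it expresses are exactly those identified with the given one. -/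

import Mathlib

open scoped unitInterval

universe u v w

namespace LeftCubical

/-! ### Left cubical balls of dimension 2 -/

/-- A space together with a family of singular squares `I² → B` and a chosen point `0`. -/
structure CubicalData where
  carrier : Type u
  [top : TopologicalSpace carrier]
  Cell : Type
  cube : Cell → C(I × I, carrier)
  zero : carrier

attribute [instance] CubicalData.top

/-- The three open pieces `{0}`, `(0,1)`, `{1}` of the unit interval. -/
def piece : Fin 3 → Set I := ![{0}, Set.Ioo 0 1, {1}]

/-- The nine open faces of the square `I²` (four vertices, four open edges, the open square). -/
def openFace (a b : Fin 3) : Set (I × I) := piece a ×ˢ piece b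

/-- The inclusion of the face `∂⁰₁ = {0} × I` (for `s = 0`) or `∂⁰₂ = I × {0}` (for `s = 1`)
into the square. -/
def faceIncl (s : Fin 2) : C(I, I × I) :=
  if s = 0 then ⟨fun t => (0, t), by fun_prop⟩ else ⟨fun t => (t, 0), by fun_prop⟩

namespace CubicalData

/-- The parametrized face `∂⁰₁ Bᵢ` (for `s = 0`) or `∂⁰₂ Bᵢ` (for `s = 1`) of the cell `Bᵢ`. -/
def edge (B : CubicalData.{u}) (i : B.Cell) (s : Fin 2) : C(I, B.carrier) :=
  (B.cube i).comp (faceIncl s)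

/-- A left cubical ball of dimension 2: a finite regular cell complex homeomorphic to the closed
disk, all of whose 2-cells are squares `hᵢ : I² ≅ Bᵢ` (embedded cellularly, hence with the nine open
faces of `I²` going to open cells) with `hᵢ(0,0) = 0`, such that the faces `∂¹ₛ Bᵢ` lie in the
boundary of the disk while the faces `∂⁰ₛ Bᵢ` meet it only in the end point opposite to `0`. -/
structure IsLeftCubicalBall (B : CubicalData.{u}) : Prop where
  finite : Finite B.Cell
  injective : ∀ i, Function.Injective (B.cube i)
  cover : ∀ b, ∃ i p, B.cube i p = b
  /-- distinct indices give distinct (disjoint) open 2-cells -/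
  cells_distinct : ∀ i j, i ≠ j → Disjoint (B.cube i '' openFace 1 1) (B.cube j '' openFace 1 1)
  /-- the open cells partition the space: any two of them are equal or disjoint -/
  cells_partition : ∀ i j a b c d,
    B.cube i '' openFace a b = B.cube j '' openFace c d ∨
      Disjoint (B.cube i '' openFace a b) (B.cube j '' openFace c d)
  /-- the parametrizations of two squares agree along a common edge at `0` -/
  edge_compatible : ∀ i j s t,
    Set.range (B.edge i s) = Set.range (B.edge j t) → B.edge i s = B.edge j t
  cube_zero : ∀ i, B.cube i (0, 0) = B.zero
  disk : ∃ φ : B.carrier ≃ₜ Metric.closedBall (0 : EuclideanSpace ℝ (Fin 2)) 1,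
    ∀ i p, (φ (B.cube i p) : EuclideanSpace ℝ (Fin 2)) ∈ Metric.sphere 0 1 ↔ p.1 = 1 ∨ p.2 = 1

/-- Two left cubical balls are equivalent if there is a homeomorphism that preserves `0` and carries
the squares of one to the squares of the other, the parametrizations corresponding up to a
permutation of the two coordinates of `I²`. -/
def Equivalent (B : CubicalData.{u}) (B' : CubicalData.{v}) : Prop :=
  ∃ (φ : B.carrier ≃ₜ B'.carrier) (τ : B.Cell ≃ B'.Cell), φ B.zero = B'.zero ∧
    ∀ i, (∀ p, φ (B.cube i p) = B'.cube (τ i) p) ∨ (∀ p, φ (B.cube i p) = B'.cube (τ i) p.swap)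

/-- The incidence number of `∂⁰₁` (for `s = 0`) and `∂⁰₂` (for `s = 1`) in the cellular boundary
`∂[I²] = -∂⁰₁ + ∂¹₁ + ∂⁰₂ - ∂¹₂` of the square. -/
def faceSign : Fin 2 → ℤˣ := ![-1, 1]

/-- An orientation: signs `εᵢ = ±1` of the 2-cells such that `∑ εᵢ Bᵢ` is a relative fundamental
cycle, i.e. the two contributions to each interior 1-cell in `∑ εᵢ ∂Bᵢ` cancel. -/
def IsOrientation (B : CubicalData.{u}) (ε : B.Cell → ℤˣ) : Prop :=
  ∀ i j s t, (i, s) ≠ (j, t) → B.edge i s = B.edge j t →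
    ε i * faceSign s = -(ε j * faceSign t)

end CubicalData

/-- The gluing relation of `C_k`: the edge `∂⁰₂` of the `i`-th square is glued to the edge `∂⁰₁` of
the `(i+1)`-st square, indices being taken modulo `k`. -/
inductive CycGlue (k : ℕ) : (_ : ZMod k) × (I × I) → (_ : ZMod k) × (I × I) → Prop
  | glue (i : ZMod k) (t : I) : CycGlue k ⟨i, (t, 0)⟩ ⟨i + 1, (0, t)⟩

/-- `C_k`: `k` squares going cyclically around the vertex `0`. -/
def cyc (k : ℕ) : CubicalData.{0} where
  carrier := Quot (CycGlue k)
  Cell := ZMod k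
  cube i := ⟨fun p => Quot.mk _ ⟨i, p⟩, continuous_quot_mk.comp continuous_sigmaMk⟩
  zero := Quot.mk _ ⟨0, (0, 0)⟩

/-! ### Left paths and left 2-tracks in a pointed space -/

section Tracks

variable {X : Type w} [TopologicalSpace X]

/-- Left paths in `(X, x₀)`: paths ending at the basepoint. -/
def LeftPath (x₀ : X) : Type w := {a : C(I, X) // a 1 = x₀}

/-- Left 2-cubes in `(X, x₀)`. -/
def LeftCube (x₀ : X) : Type w := {α : C(I × I, X) // ∀ t, α (1, t) = x₀ ∧ α (t, 1) = x₀}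

/-- The boundary of the square. -/
def sqBoundary : Set (I × I) := {p | p.1 = 0 ∨ p.1 = 1 ∨ p.2 = 0 ∨ p.2 = 1}

/-- Homotopy of left 2-cubes relative to the boundary of the square. -/
def leftCubeSetoid (x₀ : X) : Setoid (LeftCube x₀) where
  r α β := ContinuousMap.HomotopicRel α.1 β.1 sqBoundary
  iseqv := ⟨fun α => .refl α.1, fun h => h.symm, fun h h' => h.trans h'⟩

/-- Left 2-tracks in `(X, x₀)`. -/
def LeftTrack (x₀ : X) : Type w := Quotient (leftCubeSetoid x₀)

variable {x₀ : X}

/-- The restriction of a left 2-cube to `∂⁰₁` (for `s = 0`) or `∂⁰₂` (for `s = 1`). -/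
def LeftCube.face (s : Fin 2) (α : LeftCube x₀) : LeftPath x₀ :=
  ⟨α.1.comp (faceIncl s), by
    fin_cases s
    · exact (α.2 0).2
    · exact (α.2 0).1⟩

theorem faceIncl_mem (s : Fin 2) (t : I) : faceIncl s t ∈ sqBoundary := by
  fin_cases s <;> simp [faceIncl, sqBoundary]

/-- The restriction `d⁰₁ α` (for `s = 0`) or `d⁰₂ α` (for `s = 1`) of a left 2-track. -/
def LeftTrack.face (s : Fin 2) : LeftTrack x₀ → LeftPath x₀ :=
  Quotient.lift (LeftCube.face s) (by
    rintro α β ⟨H⟩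
    apply Subtype.ext
    ext t
    exact H.fst_eq_snd (faceIncl_mem s t))

/-- The source `δ₀ α = d⁰₁ α` of a left 2-track, viewed as a morphism. -/
def LeftTrack.src (α : LeftTrack x₀) : LeftPath x₀ := α.face 0

/-- The target `δ₁ α = d⁰₂ α` of a left 2-track, viewed as a morphism. -/
def LeftTrack.tgt (α : LeftTrack x₀) : LeftPath x₀ := α.face 1

/-- The composite of a left 2-cube with the swap of the two coordinates. -/
def LeftCube.swap (α : LeftCube x₀) : LeftCube x₀ :=
  ⟨α.1.comp ⟨Prod.swap, continuous_swap⟩, fun t => ⟨(α.2 t).2, (α.2 t).1⟩⟩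

/-- The inverse of a left 2-track, represented by swapping the two coordinates. -/
def LeftTrack.inv : LeftTrack x₀ → LeftTrack x₀ :=
  Quotient.map LeftCube.swap (by
    rintro α β ⟨H⟩
    refine ⟨⟨⟨⟨fun p => H (p.1, p.2.swap), by fun_prop⟩, ?_, ?_⟩, ?_⟩⟩
    · intro p; simp [LeftCube.swap]
    · intro p; simp [LeftCube.swap]
    · intro t p hp
      have : p.swap ∈ sqBoundary := by
        simp only [sqBoundary, Set.mem_ofPred_eq, Prod.fst_swap, Prod.snd_swap] at hp ⊢
        tauto
      exact H.eq_fst t this)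

/-- `α^ε` for a sign `ε = ±1`. -/
def LeftTrack.signed (ε : ℤˣ) (α : LeftTrack x₀) : LeftTrack x₀ := if ε = 1 then α else α.inv

end Tracks

/-! ### Left 2-cubical balls and circular chains -/

variable {X : Type w} [TopologicalSpace X]

/-- An (oriented) left 2-cubical ball in `(X, x₀)`: an oriented left cubical ball of dimension 2 with
a left 2-track for each of its 2-cells, such that the tracks agree along common edges. -/
structure Left2CubicalBall (x₀ : X) extends CubicalData.{u} where
  isBall : toCubicalData.IsLeftCubicalBall
  sign : Cell → ℤˣ
  isOrientation : toCubicalData.IsOrientation sign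
  track : Cell → LeftTrack x₀
  glue : ∀ i j s t, toCubicalData.edge i s = toCubicalData.edge j t →
    (track i).face s = (track j).face t

/-- Left 2-cubical balls in `X` are identified along homeomorphisms that preserve `0`, the
parametrized 2-cells, their signs, and their tracks. -/
def Left2CubicalBall.Equivalent {x₀ : X} (β : Left2CubicalBall.{u} x₀)
    (β' : Left2CubicalBall.{v} x₀) : Prop :=
  ∃ (φ : β.carrier ≃ₜ β'.carrier) (τ : β.Cell ≃ β'.Cell), φ β.zero = β'.zero ∧
    (∀ i p, φ (β.cube i p) = β'.cube (τ i) p) ∧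
    (∀ i, β'.sign (τ i) = β.sign i) ∧ (∀ i, β'.track (τ i) = β.track i)

/-- A circular chain of `k ≥ 2` composable left 2-tracks with signs, indexed modulo `k`. -/
structure CircularChain (x₀ : X) where
  length : ℕ
  two_le : 2 ≤ length
  track : ZMod length → LeftTrack x₀
  sign : ZMod length → ℤˣ
  composable : ∀ i, ((track i).signed (sign i)).tgt = ((track (i + 1)).signed (sign (i + 1))).src

/-- `c'` arises from `c` by a cyclic permutation of the signed tracks. -/
def CircularChain.CyclicPerm {x₀ : X} (c c' : CircularChain x₀) : Prop :=
  c'.length = c.length ∧ ∃ m : ℤ, ∀ i : ℤ,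
    c'.track (i : ZMod c'.length) = c.track ((i + m : ℤ) : ZMod c.length) ∧
    c'.sign (i : ZMod c'.length) = c.sign ((i + m : ℤ) : ZMod c.length)

/-- The face of a cell of sign `ε` on which the source of `α^ε` lives. -/
def srcFace (ε : ℤˣ) : Fin 2 := if ε = 1 then 0 else 1

/-- The face of a cell of sign `ε` on which the target of `α^ε` lives. -/
def tgtFace (ε : ℤˣ) : Fin 2 := if ε = 1 then 1 else 0

/-- The chain `c` is an expression of the left 2-cubical ball `β`: the 2-cells of `β` can be listed,
each once, as `B_1, …, B_k` so that the target face of `B_i` is the source face of `B_{i+1}`, and the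
signs and tracks on these cells are those of `c`. -/
def CircularChain.Expresses {x₀ : X} (c : CircularChain x₀) (β : Left2CubicalBall.{u} x₀) : Prop :=
  ∃ e : ZMod c.length ≃ β.Cell,
    (∀ i, c.track i = β.track (e i)) ∧ (∀ i, c.sign i = β.sign (e i)) ∧
    ∀ i, β.edge (e i) (tgtFace (β.sign (e i))) = β.edge (e (i + 1)) (srcFace (β.sign (e (i + 1))))

end LeftCubical

/-! The classification rests on how squares meet around the interior vertex. Each edge at `0`
belongs to exactly two squares. A third one would have to enter the open set already filled by two
squares glued along the edge (`partner_unique`), and a lone square would exhibit a boundary point of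
a half plane as an interior point of the disk (`exists_partner`). Both arguments are invariance of
domain in the plane, `image_mem_nhds_of_injOn`, obtained by lifting logarithms through the covering
`exp`. The punctured open disk is connected, so any two squares are linked through common edges
(`eq_univ_of_adjacent`). Hence passing alternately to the other face of a square and to its partner
in the next square runs through all squares in a single cycle (`exists_cyclicListing`).

A cyclic listing gives a continuous surjection from `C_k` onto the ball. Over the open disk it is
injective by the analysis of common edges, which says nothing about coincidences on the boundary
circle. Those are excluded by a separation argument with chords, `injective_of_injOn_interior`. That
`C_k` itself is a disk is seen from explicit polar coordinates, `sectorMap`.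

Along a listing, an orientation is a choice of signs making the signed incidence number of the entry
face constant, so there are two. Fixing one selects the direction that enters every square through
its source face. The listing is then unique up to rotation, so chains are determined up to cyclic
permutation, and two balls with the same chain are identified by comparing both with `C_k`. -/

namespace LeftCubical

/-! ### Invariance of domain in the plane -/

section Planar

open Set Metric Topology

/-- Logarithms of nonvanishing functions extend along homotopies. -/
theorem exists_log_of_homotopy {A : Type*} [TopologicalSpace A] (H : C(I × A, ℂ))
    (hH : ∀ p, H p ≠ 0) (f : C(A, ℂ)) (hf : ∀ a, H (0, a) = Complex.exp (f a)) :
    ∃ g : C(A, ℂ), ∀ a, H (1, a) = Complex.exp (g a) := by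
  let H' : C(I × A, {z : ℂ // z ≠ 0}) := ⟨fun p => ⟨H p, hH p⟩, by fun_prop⟩
  have h0 : ∀ a, H' (0, a) = (fun z : ℂ ↦ (⟨_, z.exp_ne_zero⟩ : {z : ℂ // z ≠ 0})) (f a) :=
    fun a => Subtype.ext (hf a)
  refine ⟨(Complex.isCoveringMap_exp.liftHomotopy H' f h0).comp ⟨fun a => (1, a), by fun_prop⟩,
    fun a => ?_⟩
  exact (congrArg Subtype.val
    (congrFun (Complex.isCoveringMap_exp.liftHomotopy_lifts H' f h0) (1, a))).symm

/-- An odd function on the circle has no logarithm. -/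
theorem not_exists_log_of_odd (f : Circle → ℂ) (hf : ∀ z, f (-z) = -f z)
    (g : C(Circle, ℂ)) (hg : ∀ z, f z = Complex.exp (g z)) : False := by
  have hneg : Continuous fun z : Circle => -z := by
    refine Continuous.subtype_mk (f := fun z : Circle => -(z : ℂ)) (by fun_prop) _
  -- This difference takes values in the discrete fibre of `exp` over `-1`, so it is constant on the
  -- connected circle. It is also odd, hence zero, contradicting `exp 0 = 1`.
  have hc : Continuous fun z : Circle => g z - g (-z) := by fun_prop
  have hval : ∀ z, Complex.exp (g z - g (-z)) = -1 := by
    intro z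
    have h0 : f z ≠ 0 := by rw [hg]; exact Complex.exp_ne_zero _
    rw [Complex.exp_sub, ← hg, ← hg, hf, div_neg, div_self h0]
  have hconst : ∀ z w : Circle, g z - g (-z) = g w - g (-w) := by
    have key := Complex.isCoveringMap_exp.const_of_comp (A := Circle) hc (fun z w => by
      apply Subtype.ext
      simp only [hval])
    exact key
  have h1 := hconst 1 (-1)
  rw [neg_neg] at h1
  have h2 : g 1 - g (-1) = 0 := by linear_combination h1 / 2
  have := hval 1
  rw [h2, Complex.exp_zero] at this
  norm_num at this

/-- Invariance of domain in the plane, at a point. -/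
theorem image_mem_nhds_of_injOn {U : Set ℂ} {f : ℂ → ℂ} (hf : ContinuousOn f U)
    (hinj : InjOn f U) {x : ℂ} (hU : U ∈ 𝓝 x) : f '' U ∈ 𝓝 (f x) := by
  obtain ⟨r, hr, hrU⟩ := nhds_basis_closedBall.mem_iff.1 hU
  have hmem : ∀ (t : ℝ) (z : Circle), |t| ≤ 1 → x + (t * r : ℝ) * z ∈ U := by
    intro t z ht
    apply hrU
    rw [mem_closedBall, dist_self_add_left, norm_mul, Circle.norm_coe, mul_one,
      Complex.norm_real, Real.norm_eq_abs, abs_mul, abs_of_pos hr]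
    nlinarith
  have hcont : ∀ {A : Type} [TopologicalSpace A] (t : A → ℝ) (z : A → Circle),
      Continuous t → Continuous z → (∀ a, |t a| ≤ 1) →
        Continuous fun a => f (x + (t a * r : ℝ) * z a) := fun t z ht hz h =>
    hf.comp_continuous (by fun_prop) fun a => hmem _ _ (h a)
  have hI : ∀ t : I, |(t : ℝ)| ≤ 1 := fun t => by rw [abs_of_nonneg t.2.1]; exact t.2.2
  have hxU : x ∈ U := mem_of_mem_nhds hU
  have hne : ∀ (s t : ℝ) (z : Circle), |s| ≤ 1 → |t| ≤ 1 → s ≠ t →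
      f (x + (s * r : ℝ) * z) ≠ f (x + (t * r : ℝ) * z) := by
    intro s t z hs ht hst h
    have h1 := hinj (hmem s z hs) (hmem t z ht) h
    have h2 := mul_right_cancel₀ z.coe_ne_zero (add_left_cancel h1)
    exact hst (mul_right_cancel₀ hr.ne' (by exact_mod_cast h2))
  -- the distance from `f x` to the image of the circle
  obtain ⟨d, hd, hdist⟩ : ∃ d > 0, ∀ z : Circle, d ≤ dist (f (x + (1 * r : ℝ) * z)) (f x) := by
    have hc : Continuous fun z : Circle => dist (f (x + (1 * r : ℝ) * z)) (f x) :=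
      (hcont (fun _ => 1) id continuous_const continuous_id (by simp)).dist continuous_const
    obtain ⟨z, -, hz⟩ := isCompact_univ.exists_isMinOn univ_nonempty hc.continuousOn
    refine ⟨_, dist_pos.2 ?_, fun w => hz (mem_univ w)⟩
    simpa using hne 1 0 z (by simp) (by simp) one_ne_zero
  refine Filter.mem_of_superset (ball_mem_nhds _ hd) fun c hc => ?_
  -- If `c` is missed, a logarithm is carried along three nonvanishing homotopies: expand the circle
  -- from `x`, move `c` to `f x`, then push the subtracted point from the centre to the antipode.
  -- The result is odd on the circle.
  by_contra hcU
  -- a logarithm of `f (x + r z) - c`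
  obtain ⟨g₁, hg₁⟩ := exists_log_of_homotopy (A := Circle)
    ⟨fun p => f (x + ((p.1 : ℝ) * r : ℝ) * p.2) - c,
      (hcont (fun p : I × Circle => (p.1 : ℝ)) (fun p => p.2) (by fun_prop) (by fun_prop)
        fun p => hI p.1).sub continuous_const⟩
    (fun p h => hcU ⟨_, hmem p.1 p.2 (hI _), sub_eq_zero.1 h⟩)
    (.const _ (Complex.log (f x - c))) (fun a => by
      have : f x - c ≠ 0 := fun h => hcU ⟨_, hxU, sub_eq_zero.1 h⟩
      simp [Complex.exp_log this])
  -- a logarithm of `f (x + r z) - f x`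
  obtain ⟨g₂, hg₂⟩ := exists_log_of_homotopy (A := Circle)
    ⟨fun p => f (x + (1 * r : ℝ) * p.2) - (c + ((p.1 : ℝ) : ℂ) * (f x - c)),
      (hcont (fun p : I × Circle => 1) (fun p => p.2) (by fun_prop) (by fun_prop)
        fun p => by simp).sub (by fun_prop)⟩
    -- A zero would put a point of the image of the circle at distance less than `d` from `f x`.
    (fun p h => by
      have h1 := hdist p.2
      have h2 : f (x + (1 * r : ℝ) * p.2) - f x = (1 - ((p.1 : ℝ) : ℂ)) * (c - f x) := by
        have : f (x + (1 * r : ℝ) * p.2) - (c + ((p.1 : ℝ) : ℂ) * (f x - c)) = 0 := h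
        linear_combination this
      rw [dist_eq_norm, h2, norm_mul] at h1
      rw [mem_ball, dist_eq_norm] at hc
      have h3 : ‖(1 - ((p.1 : ℝ) : ℂ))‖ ≤ 1 := by
        rw [← Complex.ofReal_one, ← Complex.ofReal_sub, Complex.norm_real, Real.norm_eq_abs,
          abs_of_nonneg (sub_nonneg.2 p.1.2.2)]
        linarith [p.1.2.1]
      nlinarith [norm_nonneg (c - f x)])
    g₁ (fun a => by simpa using hg₁ a)
  -- a logarithm of `f (x + r z) - f (x - r z)`
  obtain ⟨g₃, hg₃⟩ := exists_log_of_homotopy (A := Circle)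
    ⟨fun p => f (x + (1 * r : ℝ) * p.2) - f (x + ((-(p.1 : ℝ)) * r : ℝ) * p.2),
      (hcont (fun p : I × Circle => 1) (fun p => p.2) (by fun_prop) (by fun_prop)
        fun p => by simp).sub
      (hcont (fun p : I × Circle => -(p.1 : ℝ)) (fun p => p.2) (by fun_prop) (by fun_prop)
        fun p => by rw [abs_neg]; exact hI _)⟩
    (fun p => sub_ne_zero.2 (hne _ _ _ (by simp) (by rw [abs_neg]; exact hI _)
      (by have := p.1.2.1; intro h; linarith)))
    g₂ (fun a => by simpa using hg₂ a)
  refine not_exists_log_of_odd (fun z => f (x + r * z) - f (x - r * z)) (fun z => ?_) g₃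
    fun z => ?_
  · have : ((-z : Circle) : ℂ) = -(z : ℂ) := rfl
    simp only [this, mul_neg, sub_neg_eq_add, neg_sub, ← sub_eq_add_neg]
  · simpa [sub_eq_add_neg] using hg₃ z

theorem isOpen_image_of_injOn {U : Set ℂ} {f : ℂ → ℂ} (hU : IsOpen U) (hf : ContinuousOn f U)
    (hinj : InjOn f U) : IsOpen (f '' U) := by
  rw [isOpen_iff_mem_nhds]
  rintro _ ⟨x, hx, rfl⟩
  exact image_mem_nhds_of_injOn hf hinj (hU.mem_nhds hx)

/-! ### Connectedness of the punctured disk and the punctured circle -/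

theorem isPreconnected_ball_diff_singleton {c : ℂ} (hc : c ∈ ball (0 : ℂ) 1) :
    IsPreconnected (ball (0 : ℂ) 1 \ {c}) := by
  have h := (isConnected_compl_singleton_of_one_lt_rank (by simp)
    ((Homeomorph.unitBall (E := ℂ)).symm ⟨c, hc⟩)).isPreconnected.image
    (fun z => ((Homeomorph.unitBall z : ball (0 : ℂ) 1) : ℂ)) (by fun_prop)
  convert h using 1
  ext z
  constructor
  · rintro ⟨hz, hzc⟩
    refine ⟨Homeomorph.unitBall.symm ⟨z, hz⟩, fun h => hzc ?_, by simp⟩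
    simpa using congrArg Subtype.val (Homeomorph.unitBall.symm.injective h)
  · rintro ⟨y, hy, rfl⟩
    refine ⟨Subtype.prop _, fun h => hy ?_⟩
    rw [mem_singleton_iff, ← Homeomorph.unitBall.symm_apply_apply y]
    congr 1
    exact Subtype.ext h

/-- The punctured circle is the image of `(-π, π)` under `t ↦ -v exp(it)`; the point `v` corresponds
to the excluded ends. -/
theorem isPreconnected_sphere_diff_singleton {v : ℂ} (hv : ‖v‖ = 1) :
    IsPreconnected (sphere (0 : ℂ) 1 \ {v}) := by
  have h := (isPreconnected_Ioo (a := -Real.pi) (b := Real.pi)).image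
    (fun t : ℝ => -v * Complex.exp (t * Complex.I)) (by fun_prop)
  have hv0 : v ≠ 0 := norm_ne_zero_iff.1 (by rw [hv]; exact one_ne_zero)
  convert h using 1
  ext z
  constructor
  · rintro ⟨hz, hzv⟩
    rw [mem_sphere_zero_iff_norm] at hz
    have hn : ‖z / -v‖ = 1 := by rw [norm_div, norm_neg, hv, hz, div_one]
    have he := Complex.norm_mul_exp_arg_mul_I (z / -v)
    rw [hn, Complex.ofReal_one, one_mul] at he
    refine ⟨Complex.arg (z / -v), ⟨Complex.neg_pi_lt_arg _,
      lt_of_le_of_ne (Complex.arg_le_pi _) fun hpi => hzv ?_⟩, ?_⟩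
    · rw [hpi, Complex.exp_pi_mul_I, eq_div_iff (neg_ne_zero.2 hv0)] at he
      simpa using he.symm
    · simp only [he]
      field_simp
  · rintro ⟨t, ht, rfl⟩
    refine ⟨by simp [hv, Complex.norm_exp_ofReal_mul_I], fun h => ?_⟩
    have h1 : Complex.exp (t * Complex.I) = -1 := by
      apply mul_left_cancel₀ (neg_ne_zero.2 hv0)
      simpa using h
    have h2 := congrArg Complex.arg h1
    rw [Complex.arg_exp_mul_I, (toIocMod_eq_self _).2 ⟨ht.1, by linarith [ht.2]⟩,
      Complex.arg_neg_one] at h2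
    exact ht.2.ne h2

/-! ### Chords of the disk and injectivity on its boundary -/

/-- The affine functional vanishing on the line through `p` and `q`. -/
def chordFun (p q z : ℂ) : ℝ := (q - p).re * (z - p).im - (q - p).im * (z - p).re

theorem continuous_chordFun (p q : ℂ) : Continuous (chordFun p q) := by
  unfold chordFun; fun_prop

theorem chordFun_swap (p q z : ℂ) : chordFun q p z = -chordFun p q z := by
  simp only [chordFun, Complex.sub_re, Complex.sub_im]; ring

theorem sq_add_sq_eq_one {z : ℂ} (hz : ‖z‖ = 1) : z.re ^ 2 + z.im ^ 2 = 1 := by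
  have := Complex.sq_norm z
  rw [hz, Complex.normSq_apply] at this
  linarith

/-- On the line, `z = p + t (q - p)`, and the equation of the circle reduces to `t (t - 1) = 0`. -/
theorem eq_or_eq_of_chordFun_eq_zero {p q z : ℂ} (hp : ‖p‖ = 1) (hq : ‖q‖ = 1) (hz : ‖z‖ = 1)
    (hpq : p ≠ q) (h : chordFun p q z = 0) : z = p ∨ z = q := by
  have hp' := sq_add_sq_eq_one hp
  have hq' := sq_add_sq_eq_one hq
  have hz' := sq_add_sq_eq_one hz
  obtain ⟨a, b⟩ := p
  obtain ⟨c, d⟩ := q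
  obtain ⟨x, y⟩ := z
  simp only [chordFun, Complex.sub_re, Complex.sub_im] at *
  have hD : 0 < (c - a) ^ 2 + (d - b) ^ 2 := by
    rcases lt_or_eq_of_le (by positivity : 0 ≤ (c - a) ^ 2 + (d - b) ^ 2) with h | h
    · exact h
    · refine absurd ?_ hpq
      have h1 : c - a = 0 := by nlinarith [sq_nonneg (c - a), sq_nonneg (d - b)]
      have h2 : d - b = 0 := by nlinarith [sq_nonneg (c - a), sq_nonneg (d - b)]
      rw [Complex.mk.injEq]; exact ⟨by linarith, by linarith⟩
  obtain ⟨t, ht⟩ : ∃ t, t * ((c - a) ^ 2 + (d - b) ^ 2) = (c - a) * (x - a) + (d - b) * (y - b) :=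
    ⟨_, div_mul_cancel₀ _ hD.ne'⟩
  have hx : x - a = t * (c - a) := by
    apply mul_right_cancel₀ hD.ne'
    linear_combination -(d - b) * h - (c - a) * ht
  have hy : y - b = t * (d - b) := by
    apply mul_right_cancel₀ hD.ne'
    linear_combination (c - a) * h - (d - b) * ht
  have hx' : x = a + t * (c - a) := by linarith
  have hy' : y = b + t * (d - b) := by linarith
  have htt : t * (t - 1) = 0 := by
    apply mul_right_cancel₀ hD.ne'
    rw [hx', hy'] at hz'
    linear_combination hz' - (1 - t) * hp' - t * hq'
  rcases mul_eq_zero.1 htt with h0 | h0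
  · left; rw [hx', hy', h0]; simp
  · right; rw [hx', hy', sub_eq_zero.1 h0]; simp

theorem exists_chordFun_pos {p q : ℂ} (hp : ‖p‖ = 1) (hq : ‖q‖ = 1) (hpq : p ≠ q) :
    ∃ z : ℂ, ‖z‖ = 1 ∧ 0 < chordFun p q z := by
  have hr : 0 < ‖q - p‖ := norm_pos_iff.2 (sub_ne_zero.2 hpq.symm)
  have hr0 : ((‖q - p‖ : ℝ) : ℂ) ≠ 0 := by exact_mod_cast hr.ne'
  -- The unit normal of the chord. The functional there is `r` minus the cross product of `p` and
  -- `q`, and the squares of these two numbers differ by `(1 - ⟨p, q⟩)² > 0`.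
  refine ⟨Complex.I * (q - p) / (‖q - p‖ : ℝ), ?_, ?_⟩
  · rw [norm_div, norm_mul, Complex.norm_I, Complex.norm_real, norm_norm, one_mul,
      div_self hr.ne']
  have hp' := sq_add_sq_eq_one hp
  have hq' := sq_add_sq_eq_one hq
  have hsq := Complex.sq_norm (q - p)
  rw [Complex.normSq_apply] at hsq
  set r := ‖q - p‖
  simp only [chordFun, Complex.sub_re, Complex.sub_im, Complex.div_ofReal_re,
    Complex.div_ofReal_im, Complex.mul_re, Complex.mul_im, Complex.I_re, Complex.I_im] at *
  obtain ⟨a, b⟩ := p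
  obtain ⟨c, d⟩ := q
  simp only at *
  have e : (c - a) * ((0 * (d - b) + 1 * (c - a)) / r - b) -
      (d - b) * ((0 * (c - a) - 1 * (d - b)) / r - a) = r - (c * b - d * a) := by
    field_simp
    linear_combination -hsq
  rw [e, sub_pos]
  apply lt_of_pow_lt_pow_left₀ 2 hr.le
  have hm : 0 < 1 - (a * c + b * d) := by nlinarith
  nlinarith [mul_pos hm hm]

/-- By the intermediate value theorem on the circle, the functional takes every value between `0`
(at `p`) and some positive number. -/
theorem infinite_chordFun_pos {p q : ℂ} (hp : ‖p‖ = 1) (hq : ‖q‖ = 1) (hpq : p ≠ q) :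
    {z : ℂ | ‖z‖ = 1 ∧ 0 < chordFun p q z}.Infinite := by
  obtain ⟨n, hn, hn0⟩ := exists_chordFun_pos hp hq hpq
  have hpre : IsPreconnected (sphere (0 : ℂ) 1) := isPreconnected_sphere (by simp) _ _
  have := hpre.intermediate_value (mem_sphere_zero_iff_norm.2 hp) (mem_sphere_zero_iff_norm.2 hn)
    (continuous_chordFun p q).continuousOn
  have h0 : chordFun p q p = 0 := by simp [chordFun]
  rw [h0] at this
  intro hfin
  refine (Ioc_infinite hn0) ((hfin.image (chordFun p q)).subset fun t ht => ?_)
  obtain ⟨z, hz, rfl⟩ := this ⟨ht.1.le, ht.2⟩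
  exact ⟨z, ⟨mem_sphere_zero_iff_norm.1 hz, ht.1⟩, rfl⟩

/-- A map from the closed disk onto itself that is injective on the interior, preserves interior and
boundary, and has finite fibres, is injective. -/
theorem injective_of_injOn_interior (f : closedBall (0 : ℂ) 1 → ℂ) (hf : Continuous f)
    (hrange : range f = closedBall 0 1) (hS : ∀ z, ‖f z‖ = 1 ↔ ‖(z : ℂ)‖ = 1)
    (hinj : ∀ z z', ‖f z‖ < 1 → f z = f z' → z = z') (hfin : ∀ w, (f ⁻¹' {w}).Finite) :
    Function.Injective f := by
  have hle : ∀ z, ‖f z‖ ≤ 1 := fun z => by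
    have : f z ∈ closedBall (0 : ℂ) 1 := hrange ▸ mem_range_self z
    simpa using this
  intro p q hpq
  by_contra hne
  have hfp : ‖f p‖ = 1 := by
    by_contra h
    exact hne (hinj p q (lt_of_le_of_ne (hle p) h) hpq)
  have hp : ‖(p : ℂ)‖ = 1 := (hS p).1 hfp
  have hq : ‖(q : ℂ)‖ = 1 := (hS q).1 (hpq ▸ hfp)
  have hne' : (p : ℂ) ≠ q := fun h => hne (Subtype.ext h)
  set l : closedBall (0 : ℂ) 1 → ℝ := fun z => chordFun p q z with hl
  have hlc : Continuous l := (continuous_chordFun _ _).comp continuous_subtype_val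
  have hclosed : ∀ A : Set (closedBall (0 : ℂ) 1), IsClosed A → IsClosed (f '' A) := fun A hA =>
    (hA.isCompact.image hf).isClosed
  have hP : IsClosed {z | 0 ≤ l z} := isClosed_le continuous_const hlc
  have hN : IsClosed {z | l z ≤ 0} := isClosed_le hlc continuous_const
  have hB : IsClosed {z : closedBall (0 : ℂ) 1 | ‖(z : ℂ)‖ = 1} :=
    isClosed_eq (by fun_prop) continuous_const
  have hl0 : ∀ z, l z = 0 → ‖f z‖ = 1 → f z = f p := by
    intro z hz hz1
    rcases eq_or_eq_of_chordFun_eq_zero hp hq ((hS z).1 hz1) hne' hz with h | h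
    · rw [Subtype.ext h]
    · rw [Subtype.ext h, hpq]
  have hcov : sphere (0 : ℂ) 1 \ {f p} ⊆
      f '' ({z | 0 ≤ l z} ∩ {z | ‖(z : ℂ)‖ = 1}) ∪
        f '' ({z | l z ≤ 0} ∩ {z | ‖(z : ℂ)‖ = 1}) := by
    rintro w ⟨hw, -⟩
    obtain ⟨z, rfl⟩ : w ∈ range f := by rw [hrange]; exact sphere_subset_closedBall hw
    have hz := (hS z).1 (by simpa using hw)
    rcases le_total 0 (l z) with h | h
    exacts [Or.inl ⟨z, ⟨h, hz⟩, rfl⟩, Or.inr ⟨z, ⟨h, hz⟩, rfl⟩]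
  -- The chord from `p` to `q` cuts the circle into two arcs whose closed images cover the circle
  -- minus `f p`. By connectedness the images meet away from `f p`.
  have hmeet := isPreconnected_closed_iff.1 (isPreconnected_sphere_diff_singleton hfp) _ _
    (hclosed _ (hP.inter hB)) (hclosed _ (hN.inter hB)) hcov
  -- An open arc is infinite and the fibre over `f p` is finite, so neither arc collapses to `f p`.
  have hside : ∀ p q : closedBall (0 : ℂ) 1, ‖(p : ℂ)‖ = 1 → ‖(q : ℂ)‖ = 1 → (p : ℂ) ≠ q →
      ∃ z : closedBall (0 : ℂ) 1, ‖(z : ℂ)‖ = 1 ∧ 0 < chordFun p q z ∧ f z ≠ f p := by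
    intro p q hp hq hne
    by_contra! hall
    refine infinite_chordFun_pos hp hq hne (((hfin (f p)).image Subtype.val).subset ?_)
    rintro z ⟨hz, hz0⟩
    exact ⟨⟨z, by simp [hz]⟩, hall ⟨z, by simp [hz]⟩ hz hz0, rfl⟩
  obtain ⟨z₁, hz₁, hz₁0, hz₁p⟩ := hside p q hp hq hne'
  obtain ⟨z₂, hz₂, hz₂0, hz₂p⟩ := hside q p hq hp hne'.symm
  rw [chordFun_swap] at hz₂0
  obtain ⟨w, ⟨hw, hwp⟩, ⟨x, ⟨hx0, hx⟩, rfl⟩, ⟨y, ⟨hy0, hy⟩, hxy⟩⟩ := hmeet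
    ⟨f z₁, ⟨by simpa using (hS z₁).2 hz₁, hz₁p⟩, z₁, ⟨hz₁0.le, hz₁⟩, rfl⟩
    ⟨f z₂, ⟨by simpa using (hS z₂).2 hz₂, by rwa [← hpq] at hz₂p⟩, z₂,
      ⟨(neg_pos.1 hz₂0).le, hz₂⟩, rfl⟩
  have hxpos : 0 < l x := lt_of_le_of_ne hx0 fun h => hwp (hl0 x h.symm ((hS x).2 hx))
  have hyneg : l y < 0 := lt_of_le_of_ne hy0 fun h =>
    hwp (hxy ▸ hl0 y h ((hS y).2 hy))
  -- a convex neighbourhood of `f x` in the open disk that avoids the image of the chord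
  have hchord : f x ∉ f '' {z | l z = 0} := by
    rintro ⟨z, hz, hzx⟩
    exact hwp (hzx ▸ hl0 z hz (by rw [hzx]; exact (hS x).2 hx))
  obtain ⟨δ, hδ, hball⟩ := Metric.isOpen_iff.1
    (hclosed _ (isClosed_eq hlc continuous_const)).isOpen_compl _ hchord
  have hconn : IsPreconnected (ball (f x) δ ∩ ball (0 : ℂ) 1) :=
    ((convex_ball _ _).inter (convex_ball _ _)).isPreconnected
  have hnear : ∀ (z : closedBall (0 : ℂ) 1) (V : Set (closedBall (0 : ℂ) 1)), IsOpen V → z ∈ V →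
      f z = f x → ∃ z' ∈ V, f z' ∈ ball (f x) δ ∩ ball (0 : ℂ) 1 := by
    intro z V hV hzV hzx
    obtain ⟨V', hV', hVV'⟩ := isOpen_induced_iff.1
      (hV.inter (isOpen_ball.preimage hf : IsOpen (f ⁻¹' ball (f x) δ)))
    have hz : (z : ℂ) ∈ closure (ball (0 : ℂ) 1) := by
      rw [closure_ball _ one_ne_zero]; exact z.2
    have hzV' : (z : ℂ) ∈ V' := by
      change z ∈ Subtype.val ⁻¹' V'
      rw [hVV']
      exact ⟨hzV, by simp [hzx, hδ]⟩
    obtain ⟨y, hy, hy1⟩ := mem_closure_iff.1 hz V' hV' hzV'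
    have hyV : (⟨y, ball_subset_closedBall hy1⟩ : closedBall (0 : ℂ) 1) ∈ Subtype.val ⁻¹' V' := hy
    rw [hVV'] at hyV
    refine ⟨_, hyV.1, hyV.2, ?_⟩
    rw [mem_ball_zero_iff] at hy1 ⊢
    exact lt_of_le_of_ne (hle _) fun h => hy1.ne ((hS _).1 h)
  -- Near `f x` and off the image of the chord, no point comes from both sides, by interior
  -- injectivity. So the complements of the two images cover a connected set and both meet it; a
  -- common point lies outside the range of `f`, against surjectivity.
  have hO := hconn _ _ (hclosed _ hN).isOpen_compl (hclosed _ hP).isOpen_compl (by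
      rintro c ⟨hc, hc1⟩
      rw [← compl_inter]
      rintro ⟨⟨z, hz, rfl⟩, ⟨z', hz', hzz'⟩⟩
      obtain rfl := hinj z z' (by simpa using hc1) hzz'.symm
      exact hball hc ⟨z, le_antisymm hz hz', rfl⟩)
    (by
      obtain ⟨z, hz, hzb⟩ := hnear x {z | 0 < l z} (isOpen_lt continuous_const hlc) hxpos rfl
      refine ⟨f z, hzb, ?_⟩
      rintro ⟨z', hz', hzz'⟩
      obtain rfl := hinj z z' (by simpa using hzb.2) hzz'.symm
      exact (lt_irrefl (0 : ℝ)) (hz.trans_le hz'))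
    (by
      obtain ⟨z, hz, hzb⟩ := hnear y {z | l z < 0} (isOpen_lt hlc continuous_const) hyneg hxy
      refine ⟨f z, hzb, ?_⟩
      rintro ⟨z', hz', hzz'⟩
      obtain rfl := hinj z z' (by simpa using hzb.2) hzz'.symm
      exact (lt_irrefl (0 : ℝ)) (lt_of_le_of_lt hz' hz))
  obtain ⟨c, ⟨-, hc1⟩, hcN, hcP⟩ := hO
  obtain ⟨z, rfl⟩ : c ∈ range f := by rw [hrange]; exact ball_subset_closedBall hc1
  rcases le_total 0 (l z) with h | h
  exacts [hcP ⟨z, h, rfl⟩, hcN ⟨z, h, rfl⟩]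

end Planar

/-! ### The local structure of left cubical balls -/

section Faces

open Set Topology

@[simp] theorem faceIncl_zero (t : I) : faceIncl 0 t = (0, t) := rfl

@[simp] theorem faceIncl_one (t : I) : faceIncl 1 t = (t, 0) := rfl

theorem openFace_one_one : openFace 1 1 = Ioo (0 : I) 1 ×ˢ Ioo (0 : I) 1 := rfl

theorem dense_openSquare : Dense (Ioo (0 : I) 1 ×ˢ Ioo (0 : I) 1) := by
  intro p
  rw [closure_prod_eq, closure_Ioo zero_ne_one]
  exact ⟨⟨p.1.2.1, p.1.2.2⟩, ⟨p.2.2.1, p.2.2.2⟩⟩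

theorem faceIncl_image_Ioo (s : Fin 2) :
    ∃ a b, faceIncl s '' Ioo 0 1 = openFace a b := by
  fin_cases s
  · exact ⟨0, 1, by simp [openFace, piece, singleton_prod]; rfl⟩
  · exact ⟨1, 0, by simp [openFace, piece, prod_singleton]; rfl⟩

theorem exists_eq_faceIncl {p : I × I} (h1 : p.1 ≠ 1) (h2 : p.2 ≠ 1) (h0 : p ≠ (0, 0))
    (hp : p ∉ Ioo (0 : I) 1 ×ˢ Ioo (0 : I) 1) : ∃ s, ∃ t ∈ Ioo (0 : I) 1, p = faceIncl s t := by
  obtain ⟨x, y⟩ := p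
  have hpos : ∀ z : I, z ≠ 0 → 0 < z := fun z hz => lt_of_le_of_ne z.2.1 (Ne.symm hz)
  have hlt : ∀ z : I, z ≠ 1 → z < 1 := fun z hz => lt_of_le_of_ne z.2.2 hz
  by_cases hx : x = 0
  · subst hx
    exact ⟨0, y, ⟨hpos y fun h => h0 (by rw [h]), hlt y h2⟩, rfl⟩
  · by_cases hy : y = 0
    · subst hy
      exact ⟨1, x, ⟨hpos x hx, hlt x h1⟩, rfl⟩
    · exact absurd ⟨⟨hpos x hx, hlt x h1⟩, ⟨hpos y hy, hlt y h2⟩⟩ hp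

theorem faceIncl_eq_iff {s t : Fin 2} {x y : I} (hx : x ∈ Ioo (0 : I) 1) :
    faceIncl s x = faceIncl t y ↔ s = t ∧ x = y := by
  have h0' := hx.1.ne'
  fin_cases s <;> fin_cases t <;> simp [h0']

end Faces

namespace CubicalData

open Set Topology

variable (B : CubicalData.{u})

/-- The `i`-th square, with its coordinates permuted in such a way that the face `∂⁰ₛ Bᵢ`
becomes the face `{0} × I`. -/
def page (x : B.Cell × Fin 2) : C(I × I, B.carrier) :=
  if x.2 = 0 then B.cube x.1 else (B.cube x.1).comp ⟨Prod.swap, continuous_swap⟩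

variable {B}

theorem page_one (i : B.Cell) (p : I × I) : B.page (i, 1) p = B.cube i p.swap := rfl

theorem page_zero_left (x : B.Cell × Fin 2) (t : I) : B.page x (0, t) = B.edge x.1 x.2 t := by
  obtain ⟨i, s⟩ := x
  fin_cases s <;> rfl

theorem page_zero_right (x : B.Cell × Fin 2) (t : I) :
    B.page x (t, 0) = B.edge x.1 (x.2 + 1) t := by
  obtain ⟨i, s⟩ := x
  fin_cases s <;> rfl

theorem page_eq_cube (x : B.Cell × Fin 2) :
    (∀ p, B.page x p = B.cube x.1 p) ∨ (∀ p, B.page x p = B.cube x.1 p.swap) := by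
  obtain ⟨i, s⟩ := x
  fin_cases s
  exacts [Or.inl fun _ => rfl, Or.inr fun _ => rfl]

theorem cube_eq_page (i : B.Cell) (s : Fin 2) (p : I × I) :
    B.cube i p = B.page (i, s) p ∨ B.cube i p = B.page (i, s) p.swap := by
  fin_cases s
  exacts [Or.inl rfl, Or.inr rfl]

namespace IsLeftCubicalBall

variable (hB : B.IsLeftCubicalBall)
include hB

/-- Moves the disk into `ℂ`, where the planar lemmas are stated. -/
theorem exists_chart : ∃ χ : B.carrier → ℂ, Continuous χ ∧ Function.Injective χ ∧
    range χ = Metric.closedBall 0 1 ∧ ∀ i p, ‖χ (B.cube i p)‖ = 1 ↔ p.1 = 1 ∨ p.2 = 1 := by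
  obtain ⟨φ, hφ⟩ := hB.disk
  let e := Complex.orthonormalBasisOneI.repr.symm
  refine ⟨fun b => e (φ b), by fun_prop,
    e.injective.comp (Subtype.val_injective.comp φ.injective), ?_, fun i p => ?_⟩
  · ext z
    constructor
    · rintro ⟨b, rfl⟩
      rw [mem_closedBall_zero_iff, e.norm_map]
      exact _root_.mem_closedBall_zero_iff.1 (φ b).2
    · intro hz
      refine ⟨φ.symm ⟨e.symm z, by simpa using hz⟩, by simp⟩
  · rw [← hφ, mem_sphere_zero_iff_norm, e.norm_map]

theorem compactSpace : CompactSpace B.carrier := by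
  obtain ⟨φ, -⟩ := hB.disk
  exact φ.symm.compactSpace

theorem t2Space : T2Space B.carrier := by
  obtain ⟨φ, -⟩ := hB.disk
  exact φ.symm.t2Space

theorem page_injective (x : B.Cell × Fin 2) : Function.Injective (B.page x) := by
  rcases B.page_eq_cube x with h | h
  · intro p q hpq
    rw [h, h] at hpq
    exact hB.injective _ hpq
  · intro p q hpq
    rw [h, h] at hpq
    exact Prod.swap_injective (hB.injective _ hpq)

theorem page_origin (x : B.Cell × Fin 2) : B.page x (0, 0) = B.zero := by
  rcases B.page_eq_cube x with h | h <;> rw [h] <;> exact hB.cube_zero _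

theorem edge_injective (i : B.Cell) (s : Fin 2) : Function.Injective (B.edge i s) := by
  intro t t' h
  rw [← page_zero_left (i, s), ← page_zero_left (i, s)] at h
  exact (Prod.ext_iff.1 (hB.page_injective _ h)).2

theorem edge_ne (i : B.Cell) {s t : Fin 2} (h : s ≠ t) : B.edge i s ≠ B.edge i t := by
  intro he
  have h1 : B.cube i (faceIncl s 1) = B.cube i (faceIncl t 1) := DFunLike.congr_fun he 1
  have h2 := hB.injective i h1
  fin_cases s <;> fin_cases t <;> simp at h h2

theorem fst_ne_of_edge_eq {x y : B.Cell × Fin 2} (hxy : x ≠ y)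
    (h : B.edge x.1 x.2 = B.edge y.1 y.2) : x.1 ≠ y.1 := by
  obtain ⟨i, s⟩ := x
  obtain ⟨j, t⟩ := y
  rintro (rfl : i = j)
  exact hB.edge_ne i (fun hst => hxy (Prod.ext rfl hst)) h

/-- A point of an open square lies on no other square. -/
theorem cube_ne_of_mem_openSquare {i j : B.Cell} (hij : i ≠ j) (p : I × I) {q : I × I}
    (hq : q ∈ Ioo (0 : I) 1 ×ˢ Ioo (0 : I) 1) : B.cube i p ≠ B.cube j q := by
  intro hpq
  obtain ⟨χ, hχ, hχi, -, -⟩ := hB.exists_chart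
  -- Clamping the coordinates makes the square a function on all of `ℂ`, injective on the open unit
  -- square, so that invariance of domain applies.
  let pr : ℂ → I × I := fun z =>
    (projIcc 0 1 zero_le_one z.re, projIcc 0 1 zero_le_one z.im)
  have hpr : Continuous pr := by fun_prop
  let U : Set ℂ := {z | z.re ∈ Ioo (0 : ℝ) 1 ∧ z.im ∈ Ioo (0 : ℝ) 1}
  have hU : IsOpen U := (isOpen_Ioo.preimage Complex.continuous_re).inter
    (isOpen_Ioo.preimage Complex.continuous_im)
  have hopen := isOpen_image_of_injOn (f := fun z => χ (B.cube j (pr z))) hU (by fun_prop) (by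
    intro z hz w hw h
    have h1 := Prod.ext_iff.1 (hB.injective j (hχi h))
    exact Complex.ext
      ((strictMonoOn_projIcc (zero_le_one' ℝ)).injOn ⟨hz.1.1.le, hz.1.2.le⟩ ⟨hw.1.1.le, hw.1.2.le⟩ h1.1)
      ((strictMonoOn_projIcc (zero_le_one' ℝ)).injOn ⟨hz.2.1.le, hz.2.2.le⟩ ⟨hw.2.1.le, hw.2.2.le⟩ h1.2))
  have hpre := hopen.preimage (f := fun p => χ (B.cube i p)) (by fun_prop)
  -- The open cell of `j` is open in the plane, so by density it also contains a point of the open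
  -- cell of `i`.
  obtain ⟨p', hp'2, hp'⟩ := dense_openSquare.exists_mem_open hpre ⟨p, by
    refine ⟨⟨q.1, q.2⟩, ⟨⟨hq.1.1, hq.1.2⟩, ⟨hq.2.1, hq.2.2⟩⟩, ?_⟩
    simp [pr, hpq]⟩
  obtain ⟨z, hz, hzp⟩ := hp'
  refine Set.disjoint_left.1 (hB.cells_distinct i j hij) ⟨p', hp'2, rfl⟩
    ⟨pr z, ⟨?_, ?_⟩, hχi hzp⟩
  · change 0 < (pr z).1 ∧ (pr z).1 < 1
    simp only [pr, projIcc_of_mem zero_le_one ⟨hz.1.1.le, hz.1.2.le⟩]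
    exact hz.1
  · change 0 < (pr z).2 ∧ (pr z).2 < 1
    simp only [pr, projIcc_of_mem zero_le_one ⟨hz.2.1.le, hz.2.2.le⟩]
    exact hz.2

theorem page_ne_of_mem_openSquare {x y : B.Cell × Fin 2} (hxy : x.1 ≠ y.1) (p : I × I) {q : I × I}
    (hq : q ∈ Ioo (0 : I) 1 ×ˢ Ioo (0 : I) 1) : B.page x p ≠ B.page y q := by
  rcases B.page_eq_cube x with h | h <;> rcases B.page_eq_cube y with h' | h' <;> rw [h, h']
  · exact hB.cube_ne_of_mem_openSquare hxy _ hq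
  · exact hB.cube_ne_of_mem_openSquare hxy _ hq.symm
  · exact hB.cube_ne_of_mem_openSquare hxy _ hq
  · exact hB.cube_ne_of_mem_openSquare hxy _ hq.symm

theorem boundary_iff {i j : B.Cell} {p q : I × I} (h : B.cube i p = B.cube j q) :
    p.1 = 1 ∨ p.2 = 1 ↔ q.1 = 1 ∨ q.2 = 1 := by
  obtain ⟨φ, hφ⟩ := hB.disk
  rw [← hφ i p, ← hφ j q, h]

/-- Open edges are open cells, so once they meet they coincide. Then so do their closures, which are
the full edges, and compatibility of parametrizations applies. -/
theorem edge_eq_of_common_point {i j : B.Cell} {s t : Fin 2} {a b : I} (ha : a ∈ Ioo (0 : I) 1)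
    (hb : b ∈ Ioo (0 : I) 1) (h : B.edge i s a = B.edge j t b) :
    B.edge i s = B.edge j t ∧ a = b := by
  have := hB.t2Space
  suffices hedge : B.edge i s = B.edge j t by
    rw [hedge] at h
    exact ⟨hedge, hB.edge_injective j t h⟩
  apply hB.edge_compatible
  have hrange : ∀ (i : B.Cell) (s : Fin 2),
      range (B.edge i s) = closure (B.cube i '' (faceIncl s '' Ioo 0 1)) := by
    intro i s
    have huniv : (univ : Set I) = closure (Ioo 0 1) := by
      rw [closure_Ioo zero_ne_one]
      exact (eq_univ_of_forall fun t => t.2).symm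
    rw [image_image, ← image_univ, huniv]
    exact image_closure_of_isCompact isClosed_closure.isCompact (B.edge i s).continuous.continuousOn
  obtain ⟨c, d, hcd⟩ := faceIncl_image_Ioo s
  obtain ⟨c', d', hcd'⟩ := faceIncl_image_Ioo t
  rw [hrange, hrange, hcd, hcd']
  rcases hB.cells_partition i j c d c' d' with heq | hdis
  · rw [heq]
  · rw [← hcd, ← hcd'] at hdis
    exact absurd h (hdis.ne_of_mem ⟨_, ⟨a, ha, rfl⟩, rfl⟩ ⟨_, ⟨b, hb, rfl⟩, rfl⟩)

/-- Distinct squares meet in the interior of the disk only at `0` and along common edges. -/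
theorem exists_common_edge {i j : B.Cell} (hij : i ≠ j) {p q : I × I} (h : B.cube i p = B.cube j q)
    (h1 : p.1 ≠ 1) (h2 : p.2 ≠ 1) (h0 : p ≠ (0, 0)) :
    ∃ s t, ∃ a ∈ Ioo (0 : I) 1, p = faceIncl s a ∧ q = faceIncl t a ∧
      B.edge i s = B.edge j t := by
  have hq : ¬(q.1 = 1 ∨ q.2 = 1) := fun hq => by
    rcases (hB.boundary_iff h).2 hq with h' | h'
    exacts [h1 h', h2 h']
  push Not at hq
  have hq0 : q ≠ (0, 0) := by
    rintro rfl
    rw [hB.cube_zero, ← hB.cube_zero i] at h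
    exact h0 (hB.injective i h)
  obtain ⟨s, a, ha, rfl⟩ := exists_eq_faceIncl h1 h2 h0
    fun hp => hB.cube_ne_of_mem_openSquare hij.symm q hp h.symm
  obtain ⟨t, b, hb, rfl⟩ := exists_eq_faceIncl hq.1 hq.2 hq0
    fun hq => hB.cube_ne_of_mem_openSquare hij _ hq h
  obtain ⟨he, rfl⟩ := hB.edge_eq_of_common_point ha hb h
  exact ⟨s, t, a, ha, rfl, rfl, he⟩

/-- At most two squares meet along an edge. -/
theorem partner_unique {x y z : B.Cell × Fin 2} (hxy : x ≠ y) (hxz : x ≠ z)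
    (h : B.edge x.1 x.2 = B.edge y.1 y.2) (h' : B.edge x.1 x.2 = B.edge z.1 z.2) : y = z := by
  by_contra hyz
  have hxy1 := hB.fst_ne_of_edge_eq hxy h
  have hxz1 := hB.fst_ne_of_edge_eq hxz h'
  have hyz1 := hB.fst_ne_of_edge_eq hyz (h.symm.trans h')
  obtain ⟨χ, hχ, hχi, -, -⟩ := hB.exists_chart
  let pr : ℝ → I := projIcc 0 1 zero_le_one
  have hpr : Continuous pr := continuous_projIcc
  have hprm : ∀ t ∈ Ioo (0 : ℝ) 1, pr t ∈ Ioo (0 : I) 1 := by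
    intro t ht
    simp only [pr, projIcc_of_mem zero_le_one ⟨ht.1.le, ht.2.le⟩]
    exact ht
  have hpri : ∀ s ∈ Ico (0 : ℝ) 1, ∀ t ∈ Ico (0 : ℝ) 1, pr s = pr t → s = t := fun s hs t ht =>
    (strictMonoOn_projIcc (zero_le_one' ℝ)).injOn ⟨hs.1, hs.2.le⟩ ⟨ht.1, ht.2.le⟩
  -- The two pages are laid side by side along the imaginary axis. The map is injective on an open
  -- rectangle, which therefore has open image around the common edge.
  let g : ℂ → B.carrier := fun w =>
    if 0 ≤ w.re then B.page x (pr w.re, pr w.im) else B.page y (pr (-w.re), pr w.im)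
  have hg : Continuous g := by
    refine Continuous.if_le (by fun_prop) (by fun_prop) continuous_const Complex.continuous_re ?_
    intro w hw
    have hp0 : pr 0 = 0 := projIcc_left zero_le_one
    rw [← hw, neg_zero, hp0, page_zero_left, page_zero_left, h]
  let U : Set ℂ := {z | z.re ∈ Ioo (-1 : ℝ) 1 ∧ z.im ∈ Ioo (0 : ℝ) 1}
  have hU : IsOpen U := (isOpen_Ioo.preimage Complex.continuous_re).inter
    (isOpen_Ioo.preimage Complex.continuous_im)
  have hcross : ∀ v ∈ U, ∀ w ∈ U, 0 ≤ v.re → ¬0 ≤ w.re → g v ≠ g w := by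
    intro v hv w hw hv0 hw0 hvw
    simp only [g, if_pos hv0, if_neg hw0] at hvw
    exact hB.page_ne_of_mem_openSquare hxy1 _
      ⟨hprm _ ⟨by linarith, by linarith [hw.1.1]⟩, hprm _ hw.2⟩ hvw
  have hopen := isOpen_image_of_injOn (f := fun w => χ (g w)) hU (by fun_prop) (by
    intro v hv w hw hvw
    have hvw' : g v = g w := hχi hvw
    have him : ∀ {z}, z ∈ U → z.im ∈ Ico (0 : ℝ) 1 := fun hz => ⟨hz.2.1.le, hz.2.2⟩
    by_cases hv0 : 0 ≤ v.re <;> by_cases hw0 : 0 ≤ w.re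
    · simp only [g, if_pos hv0, if_pos hw0] at hvw'
      obtain ⟨h1, h2⟩ := Prod.ext_iff.1 (hB.page_injective _ hvw')
      exact Complex.ext (hpri _ ⟨hv0, hv.1.2⟩ _ ⟨hw0, hw.1.2⟩ h1)
        (hpri _ (him hv) _ (him hw) h2)
    · exact absurd hvw' (hcross v hv w hw hv0 hw0)
    · exact absurd hvw'.symm (hcross w hw v hv hw0 hv0)
    · simp only [g, if_neg hv0, if_neg hw0] at hvw'
      obtain ⟨h1, h2⟩ := Prod.ext_iff.1 (hB.page_injective _ hvw')
      have := hpri _ ⟨by linarith, by linarith [hv.1.1]⟩ _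
        ⟨by linarith, by linarith [hw.1.1]⟩ h1
      exact Complex.ext (neg_injective this) (hpri _ (him hv) _ (him hw) h2))
  -- A third page through this edge would have points of its open square in that image, hence in one
  -- of the first two pages.
  have hpre := hopen.preimage (f := fun p => χ (B.page z p)) (by fun_prop)
  obtain ⟨p, hp, w, hw, hwp⟩ := dense_openSquare.exists_mem_open hpre
    ⟨(0, pr (1 / 2)), ⟨0, 1 / 2⟩, ⟨by norm_num, by norm_num⟩, by
      have hp0 : pr 0 = 0 := projIcc_left zero_le_one
      simp only [g, le_refl, if_true, page_zero_left, ← h', hp0]⟩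
  have hwp' : g w = B.page z p := hχi hwp
  by_cases hw0 : 0 ≤ w.re
  · simp only [g, if_pos hw0] at hwp'
    exact hB.page_ne_of_mem_openSquare hxz1 _ hp hwp'
  · simp only [g, if_neg hw0] at hwp'
    exact hB.page_ne_of_mem_openSquare hyz1 _ hp hwp'

/-- At least two squares meet along an edge. -/
theorem exists_partner (x : B.Cell × Fin 2) :
    ∃ y, y ≠ x ∧ B.edge y.1 y.2 = B.edge x.1 x.2 := by
  by_contra! hno
  have := hB.finite
  have := hB.compactSpace
  obtain ⟨χ, hχ, hχi, hχr, hχb⟩ := hB.exists_chart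
  let m : I := ⟨1 / 2, by norm_num, by norm_num⟩
  have hm : m ∈ Ioo (0 : I) 1 := ⟨by change (0 : ℝ) < 1 / 2; norm_num,
    by change (1 / 2 : ℝ) < 1; norm_num⟩
  -- The other squares form a closed set. Without a partner it misses the midpoint of the edge, so
  -- near this point the disk lies inside the single page `x`.
  let K : Set ℂ := ⋃ j ∈ {j | j ≠ x.1}, range fun p => χ (B.cube j p)
  have hK : IsClosed K := (Set.toFinite _).isClosed_biUnion fun j _ =>
    (isCompact_range (by fun_prop)).isClosed
  have hmK : χ (B.page x (0, m)) ∉ K := by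
    simp only [K, mem_iUnion, not_exists]
    rintro j hj ⟨q, hq⟩
    rw [page_zero_left] at hq
    have hf1 : (faceIncl x.2 m).1 ≠ 1 ∧ (faceIncl x.2 m).2 ≠ 1 ∧ faceIncl x.2 m ≠ (0, 0) := by
      have := hm.1.ne'
      have := hm.2.ne
      generalize x.2 = s
      fin_cases s <;> simp_all
    obtain ⟨s, t, a, ha, hsa, -, he⟩ := hB.exists_common_edge (Ne.symm hj) (hχi hq).symm
      hf1.1 hf1.2.1 hf1.2.2
    obtain ⟨hs, -⟩ := (faceIncl_eq_iff hm).1 hsa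
    exact hno (j, t) (fun h => hj (by rw [← h])) (by rw [hs]; exact he.symm)
  let e : I × I → ℂ := fun p => χ (B.page x p)
  have hec : Continuous e := by fun_prop
  have hei : Function.Injective e := hχi.comp (hB.page_injective x)
  have hemb := hec.isClosedEmbedding hei
  have hinv : ∀ z ∈ range e, e (Function.invFun e z) = z := fun z hz => Function.invFun_eq hz
  have hinvc : ContinuousOn (Function.invFun e) (range e) := by
    rw [hemb.isInducing.continuousOn_iff]
    exact continuousOn_id.congr hinv
  have hsub : Metric.ball 0 1 ∩ Kᶜ ⊆ range e := by
    rintro z ⟨hz, hzK⟩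
    obtain ⟨b, rfl⟩ : z ∈ range χ := by rw [hχr]; exact Metric.ball_subset_closedBall hz
    obtain ⟨j, p, rfl⟩ := hB.cover b
    have hj : j = x.1 := by
      by_contra hj
      exact hzK (mem_biUnion (show j ∈ {j | j ≠ x.1} from hj) ⟨p, rfl⟩)
    subst hj
    rcases B.cube_eq_page x.1 x.2 p with h | h <;> rw [h] <;> exact ⟨_, rfl⟩
  have hmb : χ (B.page x (0, m)) ∈ Metric.ball (0 : ℂ) 1 := by
    rw [mem_ball_zero_iff]
    have hle : χ (B.page x (0, m)) ∈ Metric.closedBall (0 : ℂ) 1 := hχr ▸ mem_range_self _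
    refine lt_of_le_of_ne (mem_closedBall_zero_iff.1 hle) fun h => ?_
    have h1 := hm.2.ne
    rcases B.page_eq_cube x with hx | hx <;> rw [hx, hχb] at h <;> simp [h1] at h
  have hV : Metric.ball 0 1 ∩ Kᶜ ∈ 𝓝 (e (0, m)) :=
    (Metric.isOpen_ball.inter hK.isOpen_compl).mem_nhds ⟨hmb, hmK⟩
  -- Inverting the page embeds a planar neighbourhood of the midpoint into the unit square, so the
  -- image should be a neighbourhood of a point on the side `re = 0`.
  have himg := image_mem_nhds_of_injOn (f := fun z =>
    (((Function.invFun e z).1 : ℝ) : ℂ) + Complex.I * (((Function.invFun e z).2 : ℝ) : ℂ))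
    (by
      have := hinvc.mono hsub
      have h1 := continuous_fst.comp_continuousOn this
      have h2 := continuous_snd.comp_continuousOn this
      have h3 : Continuous fun t : I => ((t : ℝ) : ℂ) := by fun_prop
      exact (h3.comp_continuousOn h1).add (continuousOn_const.mul (h3.comp_continuousOn h2)))
    (by
      intro z hz w hw h
      have hr := congrArg Complex.re h
      have hi := congrArg Complex.im h
      simp at hr hi
      have := hinv w (hsub hw)
      rwa [← Prod.ext (Subtype.ext hr) (Subtype.ext hi), hinv z (hsub hz)] at this)
    hV
  obtain ⟨δ, hδ, hball⟩ := Metric.mem_nhds_iff.1 himg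
  have h0 : Function.invFun e (e (0, m)) = (0, m) := Function.leftInverse_invFun hei _
  rw [h0] at hball
  -- Shifting by `δ / 2` to the left stays in the ball but gives a negative real part.
  obtain ⟨z, -, hz⟩ := hball (show ((((0 : I) : ℝ) : ℂ) + Complex.I * ((m : ℝ) : ℂ)) -
      ((δ / 2 : ℝ) : ℂ) ∈ _ by
    rw [Metric.mem_ball, dist_eq_norm, sub_sub_cancel_left, norm_neg, Complex.norm_real,
      Real.norm_eq_abs, abs_of_pos (by linarith)]
    linarith)
  have := congrArg Complex.re hz
  simp at this
  linarith [(Function.invFun e z).1.2.1]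

/-- Any two squares are connected by a chain of squares with common edges. -/
theorem eq_univ_of_adjacent {S : Set B.Cell} (hne : S.Nonempty)
    (hS : ∀ i j s t, i ∈ S → B.edge i s = B.edge j t → j ∈ S) : S = univ := by
  by_contra hSu
  obtain ⟨j₀, hj₀⟩ := (ne_univ_iff_exists_notMem S).1 hSu
  obtain ⟨i₀, hi₀⟩ := hne
  have := hB.finite
  obtain ⟨χ, hχ, hχi, hχr, hχb⟩ := hB.exists_chart
  have hlt : ∀ i p, ‖χ (B.cube i p)‖ < 1 ↔ ¬(p.1 = 1 ∨ p.2 = 1) := by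
    intro i p
    rw [← hχb i p]
    have hle : χ (B.cube i p) ∈ Metric.closedBall (0 : ℂ) 1 := hχr ▸ mem_range_self _
    exact (mem_closedBall_zero_iff.1 hle).lt_iff_ne
  let A : Set B.Cell → Set ℂ := fun T => ⋃ j ∈ T, range fun p => χ (B.cube j p)
  have hA : ∀ T, IsClosed (A T) := fun T => (Set.toFinite _).isClosed_biUnion fun j _ =>
    (isCompact_range (by fun_prop)).isClosed
  have hz : χ B.zero ∈ Metric.ball (0 : ℂ) 1 := by
    rw [← hB.cube_zero i₀, mem_ball_zero_iff, hlt]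
    simp
  let m : I := ⟨1 / 2, by norm_num, by norm_num⟩
  have hm : m ∈ Ioo (0 : I) 1 := ⟨by change (0 : ℝ) < 1 / 2; norm_num,
    by change (1 / 2 : ℝ) < 1; norm_num⟩
  have hmid : ∀ T : Set B.Cell, T.Nonempty →
      ((Metric.ball (0 : ℂ) 1 \ {χ B.zero}) ∩ A T).Nonempty := by
    rintro T ⟨i, hi⟩
    refine ⟨χ (B.cube i (m, m)), ⟨?_, ?_⟩, mem_biUnion hi ⟨_, rfl⟩⟩
    · rw [mem_ball_zero_iff, hlt]
      simp [hm.2.ne]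
    · rw [mem_singleton_iff, ← hB.cube_zero i]
      intro h
      have := congrArg Prod.fst (hB.injective i (hχi h))
      exact hm.1.ne' this
  -- The squares in `S` and those outside form two closed sets covering the connected punctured open
  -- disk. A common point is interior and different from `0`, so it lies on a common edge.
  obtain ⟨c, ⟨hc, hc0⟩, hcS, hcS'⟩ := isPreconnected_closed_iff.1
    (isPreconnected_ball_diff_singleton hz) (A S) (A Sᶜ) (hA _) (hA _) (by
      rintro c ⟨hc, -⟩
      obtain ⟨b, rfl⟩ : c ∈ range χ := by rw [hχr]; exact Metric.ball_subset_closedBall hc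
      obtain ⟨j, p, rfl⟩ := hB.cover b
      by_cases hj : j ∈ S
      exacts [Or.inl (mem_biUnion hj ⟨p, rfl⟩), Or.inr (mem_biUnion hj ⟨p, rfl⟩)])
    (hmid S ⟨i₀, hi₀⟩) (hmid Sᶜ ⟨j₀, hj₀⟩)
  simp only [A, mem_iUnion] at hcS hcS'
  obtain ⟨i, hi, p, rfl⟩ := hcS
  obtain ⟨j, hj, q, hq⟩ := hcS'
  have hp := (hlt i p).1 (mem_ball_zero_iff.1 hc)
  push Not at hp
  obtain ⟨s, t, -, -, -, -, he⟩ := hB.exists_common_edge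
    (show i ≠ j from fun h => hj (h ▸ hi)) (hχi hq).symm
    hp.1 hp.2 (by
      rintro rfl
      exact hc0 (congrArg χ (hB.cube_zero i)))
  exact hj (hS i j s t hi he)

end IsLeftCubicalBall
end CubicalData

/-! ### Cyclic listings of the squares of a left cubical ball -/

theorem zmod_eq_of_apply_add_one {k : ℕ} [NeZero k] {α : Type*} {f : ZMod k → α}
    (h : ∀ i, f (i + 1) = f i) (i : ZMod k) : f i = f 0 := by
  have key : ∀ n : ℕ, f (n : ZMod k) = f 0 := by
    intro n
    induction n with
    | zero => simp
    | succ n ih => rw [Nat.cast_succ, h, ih]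
  rw [← ZMod.natCast_zmod_val i, key]

theorem fin_two_eq_or (a s : Fin 2) : a = s ∨ a = s + 1 := by
  revert a s; decide

theorem fin_two_add_one_add_one (s : Fin 2) : s + 1 + 1 = s := by
  revert s; decide

theorem fin_two_add_one_ne (s : Fin 2) : s + 1 ≠ s := by
  revert s; decide

namespace CubicalData

variable {B : CubicalData.{u}}

theorem faceSign_add_one (s : Fin 2) : faceSign (s + 1) = -faceSign s := by
  fin_cases s <;> rfl

/-- The squares of `B`, listed as `e i` for `i` modulo `k`, follow each other cyclically around `0`:
the square `e i` is entered through its face `s i`, and left through the other one. -/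
def IsCyclicListing (B : CubicalData.{u}) {k : ℕ} (e : ZMod k ≃ B.Cell) (s : ZMod k → Fin 2) :
    Prop :=
  ∀ i, B.edge (e i) (s i + 1) = B.edge (e (i + 1)) (s (i + 1))

namespace IsLeftCubicalBall

variable (hB : B.IsLeftCubicalBall)
include hB

/-- Let `τ` exchange the two faces on an edge and `ρ` the two faces of a square. The orbit of `x`
under `τ ∘ ρ` meets every square exactly once: at most once since `τ` and `ρ` have no fixed points,
at least once since the squares met are closed under adjacency. -/
theorem exists_cyclicListing (x : B.Cell × Fin 2) :
    ∃ k : ℕ, 2 ≤ k ∧ ∃ (e : ZMod k ≃ B.Cell) (s : ZMod k → Fin 2),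
      B.IsCyclicListing e s ∧ e 0 = x.1 ∧ s 0 = x.2 := by
  have := hB.finite
  choose τ hτ hτe using hB.exists_partner
  have hττ : ∀ y, τ (τ y) = y := fun y =>
    hB.partner_unique (hτ (τ y)).symm (hτ y) (hτe (τ y)).symm (hτe y)
  let ρ : B.Cell × Fin 2 → B.Cell × Fin 2 := fun y => (y.1, y.2 + 1)
  have hρρ : ∀ y, ρ (ρ y) = y := fun y => Prod.ext rfl (fin_two_add_one_add_one y.2)
  have hρ : ∀ y, ρ y ≠ y := fun y h => fin_two_add_one_ne y.2 (congrArg Prod.snd h)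
  let w := τ ∘ ρ
  have hw : Function.Injective w := by
    intro y z h
    rw [← hρρ y, ← hττ (ρ y), ← hρρ z, ← hττ (ρ z)]
    exact congrArg (fun a => ρ (τ a)) h
  set k := Function.minimalPeriod w x with hk
  have hk0 : 0 < k := Function.minimalPeriod_pos_of_mem_periodicPts
    (hw.mem_periodicPts x)
  have : NeZero k := ⟨hk0.ne'⟩
  let ν : ZMod k → B.Cell × Fin 2 := fun i => w^[i.val] x
  have hνcast : ∀ n : ℕ, ν n = w^[n] x := fun n => by
    simp only [ν, ZMod.val_natCast]
    exact Function.iterate_mod_minimalPeriod_eq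
  have hνsucc : ∀ i, ν (i + 1) = w (ν i) := fun i => by
    have : i + 1 = ((i.val + 1 : ℕ) : ZMod k) := by
      rw [Nat.cast_succ, ZMod.natCast_zmod_val]
    rw [this, hνcast, Function.iterate_succ_apply']
  have hνinj : Function.Injective ν := fun i j h => by
    exact ZMod.val_injective k
      (Function.iterate_injOn_Iio_minimalPeriod (ZMod.val_lt i) (ZMod.val_lt j) h)
  -- If both faces of a square occurred, the orbit would be folded: `a + n` would face `b - n` for
  -- all `n`. In the middle, according to the parity of `b - a`, either `ρ` or `τ` would fix a face.
  have hνne : ∀ a b, ν a ≠ ρ (ν b) := by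
    intro a b h
    have hstep : ∀ n : ℕ, ν (a + n) = ρ (ν (b - n)) := by
      intro n
      induction n with
      | zero => simpa using h
      | succ n ih =>
        have h1 := hνsucc (b - (n + 1 : ℕ))
        rw [show b - ((n + 1 : ℕ) : ZMod k) + 1 = b - n by push_cast; ring] at h1
        rw [show a + ((n + 1 : ℕ) : ZMod k) = a + n + 1 by push_cast; ring, hνsucc, ih]
        change τ (ρ (ρ _)) = _
        rw [hρρ, h1]
        exact hττ _
    have hd : b - a = ((b - a).val : ZMod k) := (ZMod.natCast_zmod_val _).symm
    rcases Nat.even_or_odd' (b - a).val with ⟨n, hn | hn⟩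
    · rw [hn] at hd
      push_cast at hd
      have h1 := hstep n
      rw [show b - (n : ZMod k) = a + n by linear_combination hd] at h1
      exact hρ _ h1.symm
    · rw [hn] at hd
      push_cast at hd
      have h1 := hstep n
      rw [show b - (n : ZMod k) = a + n + 1 by linear_combination hd, hνsucc] at h1
      have h2 := congrArg ρ h1
      rw [hρρ] at h2
      exact hτ _ h2.symm
  have hcell : ∀ y z : B.Cell × Fin 2, y.1 = z.1 → y = z ∨ y = ρ z := fun y z h =>
    (fin_two_eq_or y.2 z.2).imp (Prod.ext h) (Prod.ext h)
  have hinj : Function.Injective fun i => (ν i).1 := fun i j h =>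
    (hcell _ _ h).elim (fun h => hνinj h) fun h => absurd h (hνne i j)
  have hsurj : Function.Surjective fun i => (ν i).1 := by
    rw [← Set.range_eq_univ]
    refine hB.eq_univ_of_adjacent ⟨_, 0, rfl⟩ ?_
    rintro _ j s t ⟨a, rfl⟩ he
    by_cases hjt : (j, t) = ((ν a).1, s)
    · exact ⟨a, (congrArg Prod.fst hjt).symm⟩
    have hjt' : (j, t) = τ ((ν a).1, s) :=
      hB.partner_unique (Ne.symm hjt) (hτ ((ν a).1, s)).symm he (hτe _).symm
    rcases hcell ((ν a).1, s) (ν a) rfl with h | h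
    · refine ⟨a - 1, ?_⟩
      have h1 := hνsucc (a - 1)
      rw [sub_add_cancel] at h1
      rw [h, h1] at hjt'
      have h2 : (j, t) = ρ (ν (a - 1)) := hjt'.trans (hττ _)
      exact (congrArg Prod.fst h2).symm
    · refine ⟨a + 1, ?_⟩
      rw [h] at hjt'
      change (ν (a + 1)).1 = j
      rw [hνsucc]
      exact (congrArg Prod.fst hjt').symm
  have hν0 : ν 0 = x := by simpa using hνcast 0
  have hwne : ∀ y, (w y).1 ≠ y.1 := fun y =>
    hB.fst_ne_of_edge_eq (x := w y) (y := ρ y) (hτ _) (hτe _)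
  refine ⟨k, ?_, Equiv.ofBijective _ ⟨hinj, hsurj⟩, fun i => (ν i).2, ?_,
    congrArg Prod.fst hν0, congrArg Prod.snd hν0⟩
  -- For `k = 1` the step `w` would return to the same square, but partner faces lie on different
  -- squares.
  · by_contra hk2
    have hk1 : k = 1 := by omega
    refine hwne x ?_
    have h1 : w^[k] x = x := Function.iterate_minimalPeriod
    rw [hk1] at h1
    exact congrArg Prod.fst h1
  · intro i
    change B.edge (ν i).1 ((ν i).2 + 1) = B.edge (ν (i + 1)).1 (ν (i + 1)).2
    rw [hνsucc]
    exact (hτe (ρ (ν i))).symm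

variable {k : ℕ} {e : ZMod k ≃ B.Cell} {s : ZMod k → Fin 2}

/-- The listing already supplies a partner for every face, and partners are unique. -/
theorem edge_eq_iff_of_listing (hs : B.IsCyclicListing e s) {i j : ZMod k} {a b : Fin 2} :
    B.edge (e i) a = B.edge (e j) b ↔
      (i = j ∧ a = b) ∨ (j = i + 1 ∧ a = s i + 1 ∧ b = s j) ∨
        (i = j + 1 ∧ a = s i ∧ b = s j + 1) := by
  constructor
  · intro h
    by_cases hij : (e i, a) = (e j, b)
    · obtain ⟨h1, h2⟩ := Prod.ext_iff.1 hij
      exact Or.inl ⟨e.injective h1, h2⟩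
    · right
      have hne : ∀ i, (e i, s i + 1) ≠ (e (i + 1), s (i + 1)) := by
        intro i h
        obtain ⟨h1, h2⟩ := Prod.ext_iff.1 h
        have h3 := e.injective h1
        simp only [← h3] at h2
        exact fin_two_add_one_ne _ h2
      rcases fin_two_eq_or a (s i) with rfl | rfl
      · right
        have h1 := hB.partner_unique (x := (e i, s i)) hij
          (z := (e (i - 1), s (i - 1) + 1)) (fun h => hne (i - 1) (by
            rw [← h, sub_add_cancel])) h (by
            have := hs (i - 1)
            rw [sub_add_cancel] at this
            exact this.symm)
        obtain ⟨h2, h3⟩ := Prod.ext_iff.1 h1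
        obtain rfl := e.injective h2
        exact ⟨by ring, rfl, h3⟩
      · left
        have h1 := hB.partner_unique (x := (e i, s i + 1)) hij (hne i) h (hs i)
        obtain ⟨h2, h3⟩ := Prod.ext_iff.1 h1
        obtain rfl := e.injective h2
        exact ⟨rfl, rfl, h3⟩
  · rintro (⟨rfl, rfl⟩ | ⟨rfl, rfl, rfl⟩ | ⟨rfl, rfl, rfl⟩)
    exacts [rfl, hs i, (hs j).symm]

/-- The exit face has the opposite incidence number to the entry face, so cancellation along a
common edge says that the signed incidence number of the entry face is unchanged from one square to
the next. -/
theorem isOrientation_iff_of_listing [NeZero k] (hs : B.IsCyclicListing e s) (ε : B.Cell → ℤˣ) :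
    B.IsOrientation ε ↔ ∀ i, ε (e i) * faceSign (s i) = ε (e 0) * faceSign (s 0) := by
  constructor
  · intro hε
    refine zmod_eq_of_apply_add_one (f := fun i => ε (e i) * faceSign (s i)) fun i => ?_
    have h := hε (e (i + 1)) (e i) (s (i + 1)) (s i + 1) ?_ (hs i).symm
    · simpa [faceSign_add_one] using h
    · intro h
      obtain ⟨h1, h2⟩ := Prod.ext_iff.1 h
      simp only [e.injective h1] at h2
      exact fin_two_add_one_ne _ h2.symm
  · intro h i j a b hne he
    obtain ⟨i, rfl⟩ := e.surjective i
    obtain ⟨j, rfl⟩ := e.surjective j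
    rcases (hB.edge_eq_iff_of_listing hs).1 he with ⟨rfl, rfl⟩ | ⟨-, rfl, rfl⟩ | ⟨-, rfl, rfl⟩
    · exact absurd rfl hne
    · rw [faceSign_add_one, mul_neg, h i, h j]
    · rw [faceSign_add_one, mul_neg, h i, h j, neg_neg]

theorem exists_orientation_of_listing [NeZero k] (hs : B.IsCyclicListing e s) :
    ∃ ε : B.Cell → ℤˣ, ∀ ε' : B.Cell → ℤˣ, B.IsOrientation ε' ↔ ε' = ε ∨ ε' = -ε := by
  -- This choice makes the constant equal to `1`; the only other possible constant is `-1`.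
  refine ⟨fun c => faceSign (s (e.symm c)), fun ε' => ?_⟩
  rw [hB.isOrientation_iff_of_listing hs]
  constructor
  · intro h
    have h1 : ∀ c, ε' c = (ε' (e 0) * faceSign (s 0)) * faceSign (s (e.symm c)) := by
      intro c
      have := h (e.symm c)
      rw [e.apply_symm_apply] at this
      rw [← this, mul_assoc, Int.units_mul_self, mul_one]
    rcases Int.units_eq_one_or (ε' (e 0) * faceSign (s 0)) with h2 | h2 <;> rw [h2] at h1
    · exact Or.inl (funext fun c => by rw [h1, one_mul])
    · exact Or.inr (funext fun c => by rw [h1, neg_one_mul]; rfl)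
  · rintro (rfl | rfl) i
    · simp [Int.units_mul_self]
    · simp [Int.units_mul_self]

theorem cells_nonempty : Nonempty B.Cell := by
  obtain ⟨i, -⟩ := hB.cover B.zero
  exact ⟨i⟩

omit hB in
theorem page_faceIncl (x : B.Cell × Fin 2) (s : Fin 2) (t : I) :
    B.page x (faceIncl s t) = B.edge x.1 (x.2 + s) t := by
  obtain ⟨i, a⟩ := x
  fin_cases s <;> fin_cases a <;> rfl

theorem page_exists_common_edge {x y : B.Cell × Fin 2} (hxy : x.1 ≠ y.1) {p q : I × I}
    (h : B.page x p = B.page y q) (h1 : p.1 ≠ 1) (h2 : p.2 ≠ 1) (h0 : p ≠ (0, 0)) :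
    ∃ s t a, p = faceIncl s a ∧ q = faceIncl t a ∧
      B.edge x.1 (x.2 + s) = B.edge y.1 (y.2 + t) := by
  have key : ∀ (x : B.Cell × Fin 2) (p : I × I), ∃ p', B.page x p = B.cube x.1 p' ∧
      (p'.1 = 1 → p.1 = 1 ∨ p.2 = 1) ∧ (p'.2 = 1 → p.1 = 1 ∨ p.2 = 1) ∧
      (p' = (0, 0) → p = (0, 0)) ∧ ∀ s a, p' = faceIncl s a → p = faceIncl (x.2 + s) a := by
    rintro ⟨i, s⟩ ⟨a, b⟩
    fin_cases s
    · exact ⟨(a, b), rfl, Or.inl, Or.inr, id, fun s c h => by rw [h]; simp⟩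
    · refine ⟨(b, a), rfl, Or.inr, Or.inl, fun h => ?_, fun s c h => ?_⟩
      · simpa [and_comm] using h
      · fin_cases s <;> simpa [and_comm] using h
  obtain ⟨p', hp, hp1, hp2, hp0, hpf⟩ := key x p
  obtain ⟨q', hq, -, -, -, hqf⟩ := key y q
  rw [hp, hq] at h
  obtain ⟨s, t, a, -, hs, ht, he⟩ := hB.exists_common_edge hxy h
    (fun h => (hp1 h).elim h1 h2) (fun h => (hp2 h).elim h1 h2) fun h => h0 (hp0 h)
  have hadd : ∀ a s : Fin 2, a + (a + s) = s := by decide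
  exact ⟨_, _, a, hpf s a hs, hqf t a ht, by rw [hadd, hadd]; exact he⟩

end IsLeftCubicalBall
end CubicalData

/-! ### The standard balls `C_k` -/

section Cyc

open Set Topology

/-- The radial coordinate of the square. -/
def sqRadius (p : I × I) : ℝ := max p.1 p.2

/-- The angular coordinate of the square, increasing from `0` on `∂⁰₁` to `1` on `∂⁰₂`. -/
noncomputable def sqAngle (p : I × I) : ℝ := p.1 / (p.1 + p.2)

theorem sqRadius_nonneg (p : I × I) : 0 ≤ sqRadius p := le_max_of_le_left p.1.2.1

theorem sqRadius_eq_zero_iff {p : I × I} : sqRadius p = 0 ↔ p = (0, 0) := by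
  constructor
  · intro h
    have h1 : (p.1 : ℝ) ≤ 0 := h ▸ le_max_left _ _
    have h2 : (p.2 : ℝ) ≤ 0 := h ▸ le_max_right _ _
    exact Prod.ext (Subtype.ext (le_antisymm h1 p.1.2.1)) (Subtype.ext (le_antisymm h2 p.2.2.1))
  · rintro rfl
    simp [sqRadius]

theorem sqRadius_eq_one_iff {p : I × I} : sqRadius p = 1 ↔ p.1 = 1 ∨ p.2 = 1 := by
  rw [sqRadius, max_eq_iff, Subtype.ext_iff, Subtype.ext_iff]
  exact ⟨fun h => h.imp And.left And.left,
    fun h => h.imp (fun h => ⟨h, h.symm ▸ p.2.2.2⟩) fun h => ⟨h, h.symm ▸ p.1.2.2⟩⟩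

theorem continuous_sqRadius : Continuous sqRadius := by unfold sqRadius; fun_prop

theorem add_pos_of_ne_zero {p : I × I} (hp : p ≠ (0, 0)) : 0 < (p.1 : ℝ) + p.2 := by
  refine lt_of_le_of_ne (add_nonneg p.1.2.1 p.2.2.1) fun h => hp ?_
  have h1 := p.1.2.1
  have h2 := p.2.2.1
  exact Prod.ext (Subtype.ext (by change (p.1 : ℝ) = 0; linarith))
    (Subtype.ext (by change (p.2 : ℝ) = 0; linarith))

theorem sqAngle_mem (p : I × I) : sqAngle p ∈ Icc (0 : ℝ) 1 := by
  have h1 := p.1.2.1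
  have h2 := p.2.2.1
  exact ⟨div_nonneg h1 (add_nonneg h1 h2), div_le_one_of_le₀ (by linarith) (add_nonneg h1 h2)⟩

theorem sqAngle_zero_left (t : I) : sqAngle (0, t) = 0 := by simp [sqAngle]

/-- At the origin the quotient is `0 / 0 = 0`, whence the exclusion of `t = 0`. -/
theorem sqAngle_zero_right {t : I} (ht : t ≠ 0) : sqAngle (t, 0) = 1 := by
  have : (t : ℝ) ≠ 0 := fun h => ht (Subtype.ext h)
  simp [sqAngle, this]

theorem eq_zero_of_sqAngle_eq_zero {p : I × I} (hp : p ≠ (0, 0)) (h : sqAngle p = 0) :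
    p = (0, p.2) := by
  rw [sqAngle, div_eq_zero_iff] at h
  exact Prod.ext (Subtype.ext (h.resolve_right (add_pos_of_ne_zero hp).ne')) rfl

theorem eq_zero_of_sqAngle_eq_one {p : I × I} (hp : p ≠ (0, 0)) (h : sqAngle p = 1) :
    p = (p.1, 0) := by
  rw [sqAngle, div_eq_one_iff_eq (add_pos_of_ne_zero hp).ne'] at h
  exact Prod.ext rfl (Subtype.ext (by change (p.2 : ℝ) = 0; linarith))

/-- Away from the origin, equal angles make `q` a multiple `l p`, and equal maxima force `l = 1`. -/
theorem eq_of_sqRadius_eq_of_sqAngle_eq {p q : I × I} (hr : sqRadius p = sqRadius q)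
    (hθ : sqAngle p = sqAngle q) : p = q := by
  by_cases hp : p = (0, 0)
  · rw [hp, eq_comm, ← sqRadius_eq_zero_iff, ← hr, hp, sqRadius_eq_zero_iff]
  have hq : q ≠ (0, 0) := fun hq => hp (sqRadius_eq_zero_iff.1 (hr.trans
    (sqRadius_eq_zero_iff.2 hq)))
  have hp' := add_pos_of_ne_zero hp
  have hq' := add_pos_of_ne_zero hq
  rw [sqAngle, sqAngle, div_eq_div_iff hp'.ne' hq'.ne'] at hθ
  obtain ⟨⟨a, ha⟩, ⟨b, hb⟩⟩ := p
  obtain ⟨⟨c, hc⟩, ⟨d, hd⟩⟩ := q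
  simp only [sqRadius] at *
  obtain ⟨l, hl⟩ : ∃ l, l * (a + b) = c + d := ⟨_, div_mul_cancel₀ _ hp'.ne'⟩
  have hc' : c = l * a := mul_right_cancel₀ hp'.ne' (by linear_combination -hθ - a * hl)
  have hd' : d = l * b := by linear_combination -hl - hc'
  have hl0 : 0 ≤ l := nonneg_of_mul_nonneg_left (hl ▸ hq'.le) hp'
  have hm : 0 < max a b := by
    rcases lt_max_iff.2 (show 0 < a ∨ 0 < b by
      by_contra! h; linarith) with h
    exact h
  have hl1 : l = 1 := by
    rw [hc', hd', ← mul_max_of_nonneg _ _ hl0] at hr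
    exact mul_right_cancel₀ hm.ne' (by linarith)
  subst hl1
  simp [hc', hd']

theorem exists_sqRadius_sqAngle {r θ : ℝ} (hr : r ∈ Icc (0 : ℝ) 1) (hθ : θ ∈ Icc (0 : ℝ) 1) :
    ∃ p, sqRadius p = r ∧ (r ≠ 0 → sqAngle p = θ) := by
  have h0 : 0 ≤ 1 - θ := by linarith [hθ.2]
  have hm : 0 < max θ (1 - θ) := by
    rcases le_or_gt θ 0 with h | h
    · exact lt_max_of_lt_right (by linarith)
    · exact lt_max_of_lt_left h
  have h1 := le_max_left θ (1 - θ)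
  have h2 := le_max_right θ (1 - θ)
  set m := max θ (1 - θ) with hmdef
  have key : ∀ t, 0 ≤ t → t ≤ m → r * (t / m) ∈ Icc (0 : ℝ) 1 := fun t ht htm =>
    ⟨mul_nonneg hr.1 (div_nonneg ht hm.le),
      mul_le_one₀ hr.2 (div_nonneg ht hm.le) (div_le_one_of_le₀ htm hm.le)⟩
  -- The direction `(θ, 1 - θ)` has the right angle; it is rescaled to have maximum `r`.
  refine ⟨(⟨_, key θ hθ.1 h1⟩, ⟨_, key _ h0 h2⟩), ?_, fun hr0 => ?_⟩
  · simp only [sqRadius]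
    rw [← mul_max_of_nonneg _ _ hr.1, max_div_div_right hm.le, ← hmdef, div_self hm.ne', mul_one]
  · simp only [sqAngle]
    field_simp
    ring

/-! ### Sectors of the disk -/

/-- Polar coordinates on the `i`-th of `k` sectors of the closed disk. -/
noncomputable def sectorMap (k i : ℕ) (p : I × I) : ℂ :=
  sqRadius p * Complex.exp (((2 * Real.pi * ((i + sqAngle p) / k) : ℝ) : ℂ) * Complex.I)

theorem norm_sectorMap (k i : ℕ) (p : I × I) : ‖sectorMap k i p‖ = sqRadius p := by
  rw [sectorMap, norm_mul, Complex.norm_exp_ofReal_mul_I, mul_one, Complex.norm_real,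
    Real.norm_of_nonneg (sqRadius_nonneg p)]

/-- The angle is discontinuous at the origin, but there the norm, which is the radius, tends to `0`.
-/
theorem continuous_sectorMap (k i : ℕ) : Continuous (sectorMap k i) := by
  rw [continuous_iff_continuousAt]
  intro p
  by_cases hp : p = (0, 0)
  · have h0 : sectorMap k i p = 0 := by
      rw [← norm_eq_zero, norm_sectorMap, sqRadius_eq_zero_iff, hp]
    rw [ContinuousAt, h0, tendsto_zero_iff_norm_tendsto_zero]
    simp only [norm_sectorMap]
    have := continuous_sqRadius.tendsto p
    rwa [sqRadius_eq_zero_iff.2 hp] at this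
  · have hθ : ContinuousAt sqAngle p :=
      ContinuousAt.div (by fun_prop) (by fun_prop) (add_pos_of_ne_zero hp).ne'
    have hr := continuous_sqRadius.continuousAt (x := p)
    unfold sectorMap
    fun_prop

theorem exp_two_pi_eq_iff {a b : ℝ} :
    Complex.exp (((2 * Real.pi * a : ℝ) : ℂ) * Complex.I) =
      Complex.exp (((2 * Real.pi * b : ℝ) : ℂ) * Complex.I) ↔ ∃ n : ℤ, a = b + n := by
  rw [Complex.exp_eq_exp_iff_exists_int]
  refine exists_congr fun n => ?_
  have hpi : (2 * Real.pi * Complex.I : ℂ) ≠ 0 := Complex.two_pi_I_ne_zero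
  rw [show ((2 * Real.pi * a : ℝ) : ℂ) * Complex.I = a * (2 * Real.pi * Complex.I) by
      push_cast; ring,
    show ((2 * Real.pi * b : ℝ) : ℂ) * Complex.I + n * (2 * Real.pi * Complex.I) =
      (b + n) * (2 * Real.pi * Complex.I) by push_cast; ring, mul_left_inj' hpi]
  exact ⟨fun h => by exact_mod_cast h, fun h => by exact_mod_cast h⟩

variable {k : ℕ} [NeZero k]

/-- Equality means equal radii and `i + sqAngle p ≡ j + sqAngle q` modulo `k`. The difference of the
angles is then an integer in `{-1, 0, 1}` congruent to `j - i`, one value for each alternative. -/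
theorem sectorMap_eq_iff {i j : ZMod k} {p q : I × I} (hp : p ≠ (0, 0)) :
    sectorMap k i.val p = sectorMap k j.val q ↔ (i = j ∧ p = q) ∨
      (j = i + 1 ∧ ∃ t, p = (t, 0) ∧ q = (0, t)) ∨ (i = j + 1 ∧ ∃ t, p = (0, t) ∧ q = (t, 0)) := by
  have hk : (k : ℝ) ≠ 0 := by exact_mod_cast NeZero.ne k
  have hk0 : (k : ZMod k) = 0 := ZMod.natCast_self k
  have hval : ∀ i : ZMod k, (i.val : ZMod k) = i := ZMod.natCast_zmod_val
  have key : ∀ (i j : ZMod k) (p q : I × I), p ≠ (0, 0) →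
      (sectorMap k i.val p = sectorMap k j.val q ↔ sqRadius p = sqRadius q ∧
        ∃ n : ℤ, (i.val + sqAngle p : ℝ) = j.val + sqAngle q + n * k) := by
    intro i j p q hp
    have hr0 : (sqRadius p : ℂ) ≠ 0 := by
      exact_mod_cast fun h => hp (sqRadius_eq_zero_iff.1 h)
    have hdiv : (∃ n : ℤ, (i.val + sqAngle p : ℝ) = j.val + sqAngle q + n * k) ↔
        ∃ n : ℤ, (i.val + sqAngle p : ℝ) / k = (j.val + sqAngle q) / k + n := by
      refine exists_congr fun n => ?_
      rw [div_eq_iff hk, add_mul, div_mul_cancel₀ _ hk]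
    rw [hdiv, ← exp_two_pi_eq_iff]
    constructor
    · intro h
      have hr : sqRadius p = sqRadius q := by
        rw [← norm_sectorMap k i.val, h, norm_sectorMap]
      refine ⟨hr, ?_⟩
      rw [sectorMap, sectorMap, ← hr] at h
      exact mul_left_cancel₀ hr0 h
    · rintro ⟨hr, h⟩
      rw [sectorMap, sectorMap, hr, h]
  have glue : ∀ (i : ZMod k) (t : I), (t, (0 : I)) ≠ (0, 0) →
      sectorMap k i.val (t, 0) = sectorMap k (i + 1).val (0, t) := by
    intro i t ht
    have ht0 : t ≠ 0 := fun h => ht (by rw [h])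
    rw [key _ _ _ _ ht, sqAngle_zero_left, sqAngle_zero_right ht0]
    refine ⟨by simp [sqRadius, max_comm], ?_⟩
    obtain ⟨n, hn⟩ : (k : ℤ) ∣ (i.val + 1 : ℤ) - (i + 1).val := by
      rw [← ZMod.intCast_zmod_eq_zero_iff_dvd]
      push_cast
      rw [hval, hval]
      ring
    refine ⟨n, ?_⟩
    have : ((i.val + 1 : ℤ) : ℝ) - (((i + 1).val : ℤ) : ℝ) = (k : ℤ) * n := by exact_mod_cast hn
    push_cast at this
    linarith
  constructor
  · rw [key _ _ _ _ hp]
    rintro ⟨hr, n, hn⟩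
    have hq : q ≠ (0, 0) := fun hq => hp (sqRadius_eq_zero_iff.1 (hr.trans
      (sqRadius_eq_zero_iff.2 hq)))
    obtain ⟨h1, h2⟩ := sqAngle_mem p
    obtain ⟨h3, h4⟩ := sqAngle_mem q
    set N : ℤ := j.val + n * k - i.val with hN
    have hNr : sqAngle p - sqAngle q = N := by
      rw [hN]; push_cast; linarith
    have hNk : (N : ZMod k) = j - i := by
      rw [hN]; push_cast; rw [hval, hval, hk0]; ring
    have hN1 : N ≤ 1 := by
      have : (N : ℝ) ≤ 1 := by rw [← hNr]; linarith
      exact_mod_cast this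
    have hN2 : -1 ≤ N := by
      have : (-1 : ℝ) ≤ N := by rw [← hNr]; linarith
      exact_mod_cast this
    obtain h | h | h : N = 0 ∨ N = 1 ∨ N = -1 := by omega
    · left
      rw [h] at hNr hNk
      push_cast at hNr hNk
      exact ⟨(sub_eq_zero.1 hNk.symm).symm, eq_of_sqRadius_eq_of_sqAngle_eq hr (by linarith)⟩
    · right; left
      rw [h] at hNr hNk
      push_cast at hNr hNk
      have hp' := eq_zero_of_sqAngle_eq_one hp (by linarith)
      have hq' := eq_zero_of_sqAngle_eq_zero hq (by linarith)
      refine ⟨by rw [hNk]; ring, p.1, hp', ?_⟩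
      rw [hp', hq'] at hr
      simp [sqRadius, p.1.2.1, q.2.2.1] at hr
      rw [Subtype.ext hr]; exact hq'
    · right; right
      rw [h] at hNr hNk
      push_cast at hNr hNk
      have hp' := eq_zero_of_sqAngle_eq_zero hp (by linarith)
      have hq' := eq_zero_of_sqAngle_eq_one hq (by linarith)
      refine ⟨by linear_combination hNk, p.2, hp', ?_⟩
      rw [hp', hq'] at hr
      simp [sqRadius, p.2.2.1, q.1.2.1] at hr
      rw [Subtype.ext hr]; exact hq'
  · rintro (⟨rfl, rfl⟩ | ⟨rfl, t, rfl, rfl⟩ | ⟨rfl, t, rfl, rfl⟩)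
    · rfl
    · exact glue i t hp
    · exact (glue j t (by simpa using hp)).symm

theorem sectorMap_surjective {z : ℂ} (hz : ‖z‖ ≤ 1) :
    ∃ (i : ZMod k) (p : I × I), sectorMap k i.val p = z := by
  have hk : (0 : ℝ) < k := by exact_mod_cast Nat.pos_of_ne_zero (NeZero.ne k)
  -- The argument in full turns, normalized to `[0, 1)`. The integer part of `a * k` is the sector,
  -- the fractional part the angle in it.
  set a : ℝ := Int.fract (z.arg / (2 * Real.pi)) with ha
  have ha0 : 0 ≤ a := Int.fract_nonneg _
  have ha1 : a < 1 := Int.fract_lt_one _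
  have hak : 0 ≤ a * k := mul_nonneg ha0 hk.le
  have hi : ⌊a * k⌋₊ < k := by
    rw [Nat.floor_lt hak]
    nlinarith
  obtain ⟨p, hpr, hpθ⟩ := exists_sqRadius_sqAngle (r := ‖z‖) (θ := a * k - ⌊a * k⌋₊)
    ⟨norm_nonneg z, hz⟩ ⟨by linarith [Nat.floor_le hak], by linarith [Nat.lt_floor_add_one (a * k)]⟩
  refine ⟨(⌊a * k⌋₊ : ZMod k), p, ?_⟩
  rw [sectorMap, hpr, ZMod.val_natCast_of_lt hi]
  by_cases hz0 : ‖z‖ = 0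
  · rw [norm_eq_zero.1 hz0]; simp
  rw [hpθ hz0, add_sub_cancel, mul_div_cancel_right₀ _ hk.ne']
  conv_rhs => rw [← Complex.norm_mul_exp_arg_mul_I z]
  congr 1
  have : z.arg = 2 * Real.pi * (z.arg / (2 * Real.pi)) := by
    have := Real.pi_pos; field_simp
  rw [this, exp_two_pi_eq_iff]
  exact ⟨-⌊z.arg / (2 * Real.pi)⌋, by rw [ha, Int.fract]; push_cast; ring⟩

omit [NeZero k] in
theorem cyc_glue (i : ZMod k) (t : I) : (cyc k).cube i (t, 0) = (cyc k).cube (i + 1) (0, t) :=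
  Quot.sound (CycGlue.glue i t)

theorem cyc_cube_zero (i : ZMod k) : (cyc k).cube i (0, 0) = (cyc k).zero :=
  zmod_eq_of_apply_add_one (f := fun i : ZMod k => (cyc k).cube i (0, 0))
    (fun i => (cyc_glue i 0).symm) i

/-! ### `C_k` as a disk -/

/-- The embedding of `C_k` in the plane with image the closed disk. -/
noncomputable def cycChart (k : ℕ) [NeZero k] : (cyc k).carrier → ℂ :=
  Quot.lift (fun x => sectorMap k (ZMod.val x.1) x.2) (by
    rintro _ _ ⟨i, t⟩
    by_cases ht : t = 0
    · subst ht
      have : ∀ i, sectorMap k i (0, 0) = 0 := fun i => by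
        rw [← norm_eq_zero, norm_sectorMap, sqRadius_eq_zero_iff]
      simp only [this]
    · exact (sectorMap_eq_iff (by simpa using ht)).2 (Or.inr (Or.inl ⟨rfl, t, rfl, rfl⟩)))

theorem cycChart_cube (i : ZMod k) (p : I × I) :
    cycChart k ((cyc k).cube i p) = sectorMap k i.val p := rfl

theorem continuous_cycChart : Continuous (cycChart k) :=
  continuous_quot_lift _ (continuous_sigma fun i => continuous_sectorMap k (ZMod.val i))

omit [NeZero k] in
theorem cyc_cover (b : (cyc k).carrier) : ∃ (i : ZMod k) (p : I × I), (cyc k).cube i p = b := by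
  obtain ⟨⟨i, p⟩, rfl⟩ := Quot.exists_rep b
  exact ⟨i, p, rfl⟩

/-- Points of the quotient are told apart by their images in the plane, which avoids computing the
equivalence relation generated by the gluing. -/
theorem cyc_cube_eq_iff {i j : ZMod k} {p q : I × I} :
    (cyc k).cube i p = (cyc k).cube j q ↔ (i = j ∧ p = q) ∨ (p = (0, 0) ∧ q = (0, 0)) ∨
      (j = i + 1 ∧ ∃ t, p = (t, 0) ∧ q = (0, t)) ∨ (i = j + 1 ∧ ∃ t, p = (0, t) ∧ q = (t, 0)) := by
  constructor
  · intro h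
    have h1 : sectorMap k i.val p = sectorMap k j.val q := congrArg (cycChart k) h
    by_cases hp : p = (0, 0)
    · refine Or.inr (Or.inl ⟨hp, ?_⟩)
      rw [← sqRadius_eq_zero_iff, ← norm_sectorMap k j.val, ← h1, norm_sectorMap,
        sqRadius_eq_zero_iff, hp]
    · rcases (sectorMap_eq_iff hp).1 h1 with h | h | h
      exacts [Or.inl h, Or.inr (Or.inr (Or.inl h)), Or.inr (Or.inr (Or.inr h))]
  · rintro (⟨rfl, rfl⟩ | ⟨rfl, rfl⟩ | ⟨rfl, t, rfl, rfl⟩ | ⟨rfl, t, rfl, rfl⟩)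
    · rfl
    · rw [cyc_cube_zero, cyc_cube_zero]
    · exact cyc_glue i t
    · exact (cyc_glue j t).symm

theorem cycChart_injective : Function.Injective (cycChart k) := by
  intro b b' h
  obtain ⟨i, p, rfl⟩ := cyc_cover b
  obtain ⟨j, q, rfl⟩ := cyc_cover b'
  rw [cycChart_cube, cycChart_cube] at h
  rw [cyc_cube_eq_iff]
  by_cases hp : p = (0, 0)
  · refine Or.inr (Or.inl ⟨hp, ?_⟩)
    rw [← sqRadius_eq_zero_iff, ← norm_sectorMap k j.val, ← h, norm_sectorMap,
      sqRadius_eq_zero_iff, hp]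
  · rcases (sectorMap_eq_iff hp).1 h with h | h | h
    exacts [Or.inl h, Or.inr (Or.inr (Or.inl h)), Or.inr (Or.inr (Or.inr h))]

theorem range_cycChart : range (cycChart k) = Metric.closedBall 0 1 := by
  ext z
  rw [mem_closedBall_zero_iff]
  constructor
  · rintro ⟨b, rfl⟩
    obtain ⟨i, p, rfl⟩ := cyc_cover b
    rw [cycChart_cube, norm_sectorMap]
    exact max_le p.1.2.2 p.2.2.2
  · intro hz
    obtain ⟨i, p, h⟩ := sectorMap_surjective (k := k) hz
    exact ⟨(cyc k).cube i p, h⟩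

instance : CompactSpace (cyc k).carrier :=
  inferInstanceAs (CompactSpace (Quot (CycGlue k)))

theorem cyc_edge_apply_eq {i j : ZMod k} {s t : Fin 2} {a b : I} (ha : a ∈ Ioo (0 : I) 1)
    (h : (cyc k).edge i s a = (cyc k).edge j t b) :
    (i = j ∧ s = t) ∨ (j = i + 1 ∧ s = 1 ∧ t = 0) ∨ (i = j + 1 ∧ s = 0 ∧ t = 1) := by
  have ha0 := ha.1.ne'
  rcases cyc_cube_eq_iff.1 h with ⟨hij, h⟩ | ⟨h, -⟩ | ⟨hij, c, h, h'⟩ | ⟨hij, c, h, h'⟩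
  · exact Or.inl ⟨hij, ((faceIncl_eq_iff ha).1 h).1⟩
  · fin_cases s <;> simp [ha0] at h
  · right; left
    have h1 := ((faceIncl_eq_iff (t := 1) ha).1 h)
    obtain ⟨rfl, rfl⟩ := h1
    exact ⟨hij, rfl, ((faceIncl_eq_iff (s := 0) (t := t) ha).1 h'.symm).1.symm⟩
  · right; right
    have h1 := ((faceIncl_eq_iff (t := 0) ha).1 h)
    obtain ⟨rfl, rfl⟩ := h1
    exact ⟨hij, rfl, ((faceIncl_eq_iff (s := 1) (t := t) ha).1 h'.symm).1.symm⟩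

omit [NeZero k] in
theorem cyc_edge_eq (i : ZMod k) : (cyc k).edge i 1 = (cyc k).edge (i + 1) 0 :=
  ContinuousMap.ext fun t => cyc_glue i t

theorem exists_mem_Ioo : ∃ a : I, a ∈ Ioo (0 : I) 1 := exists_between zero_lt_one

theorem cyc_edge_eq_iff {i j : ZMod k} {s t : Fin 2} :
    (cyc k).edge i s = (cyc k).edge j t ↔
      (i = j ∧ s = t) ∨ (j = i + 1 ∧ s = 1 ∧ t = 0) ∨ (i = j + 1 ∧ s = 0 ∧ t = 1) := by
  constructor
  · intro h
    obtain ⟨a, ha⟩ := exists_mem_Ioo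
    exact cyc_edge_apply_eq ha (DFunLike.congr_fun h a)
  · rintro (⟨rfl, rfl⟩ | ⟨rfl, rfl, rfl⟩ | ⟨rfl, rfl, rfl⟩)
    exacts [rfl, cyc_edge_eq i, (cyc_edge_eq j).symm]

theorem piece_eq_of_mem {a b : Fin 3} {t : I} (ha : t ∈ piece a) (hb : t ∈ piece b) : a = b := by
  have h01 : (0 : I) ≠ 1 := zero_ne_one
  fin_cases a <;> fin_cases b <;> simp [piece] at ha hb <;> first | rfl | (exfalso; simp_all)

theorem piece_zero_mem {a : Fin 3} (h : (0 : I) ∈ piece a) : a = 0 :=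
  piece_eq_of_mem h rfl

theorem cyc_isLeftCubicalBall (hk : 2 ≤ k) : (cyc k).IsLeftCubicalBall where
  finite := inferInstanceAs (Finite (ZMod k))
  injective i p q h := by
    -- Here `k ≥ 2` is needed: for `k = 1` the square would be glued to itself.
    have hne : ∀ i : ZMod k, i ≠ i + 1 := by
      have : Fact (1 < k) := ⟨hk⟩
      intro i h
      exact one_ne_zero (α := ZMod k) (by linear_combination -h)
    rcases cyc_cube_eq_iff.1 h with ⟨-, h⟩ | ⟨h, h'⟩ | ⟨h, -⟩ | ⟨h, -⟩
    · exact h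
    · rw [h, h']
    · exact absurd h (hne i)
    · exact absurd h (hne i)
  cover := cyc_cover
  cells_distinct i j hij := by
    rw [Set.disjoint_left]
    rintro _ ⟨p, hp, rfl⟩ ⟨q, hq, h⟩
    rw [openFace_one_one] at hp hq
    rcases cyc_cube_eq_iff.1 h with ⟨h, -⟩ | ⟨rfl, -⟩ | ⟨-, t, rfl, -⟩ | ⟨-, t, rfl, -⟩
    · exact hij h.symm
    · exact lt_irrefl _ hq.1.1
    · exact lt_irrefl _ hq.2.1
    · exact lt_irrefl _ hq.1.1
  cells_partition i j a b c d := by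
    have glue : ∀ (i : ZMod k) (a : Fin 3), (cyc k).cube i '' openFace a 0 =
        (cyc k).cube (i + 1) '' openFace 0 a := by
      intro i a
      simp only [openFace, piece, Matrix.cons_val_zero, prod_singleton, singleton_prod,
        image_image]
      exact image_congr fun t _ => cyc_glue i t
    rw [or_iff_not_imp_right, Set.not_disjoint_iff]
    rintro ⟨_, ⟨p, hp, rfl⟩, ⟨q, hq, h⟩⟩
    rcases cyc_cube_eq_iff.1 h with ⟨rfl, rfl⟩ | ⟨rfl, rfl⟩ | ⟨rfl, t, rfl, rfl⟩ | ⟨rfl, t, rfl, rfl⟩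
    · rw [piece_eq_of_mem hp.1 hq.1, piece_eq_of_mem hp.2 hq.2]
    · rw [piece_zero_mem hp.1, piece_zero_mem hp.2, piece_zero_mem hq.1, piece_zero_mem hq.2]
      simpa [openFace, piece] using h.symm
    · rw [piece_zero_mem hp.1, piece_zero_mem hq.2, piece_eq_of_mem hp.2 hq.1]
      exact (glue j c).symm
    · rw [piece_zero_mem hp.2, piece_zero_mem hq.1, piece_eq_of_mem hp.1 hq.2]
      exact glue i d
  edge_compatible i j s t h := by
    obtain ⟨a, ha⟩ := exists_mem_Ioo
    obtain ⟨b, hb⟩ : (cyc k).edge i s a ∈ range ((cyc k).edge j t) := h ▸ mem_range_self a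
    exact cyc_edge_eq_iff.2 (cyc_edge_apply_eq ha hb.symm)
  cube_zero := cyc_cube_zero
  disk := by
    let r := Complex.orthonormalBasisOneI.repr
    have hmem : ∀ b, r (cycChart k b) ∈ Metric.closedBall (0 : EuclideanSpace ℝ (Fin 2)) 1 := by
      intro b
      have : cycChart k b ∈ Metric.closedBall (0 : ℂ) 1 := range_cycChart (k := k) ▸ mem_range_self b
      rw [mem_closedBall_zero_iff, r.norm_map]
      exact mem_closedBall_zero_iff.1 this
    let f : (cyc k).carrier → Metric.closedBall (0 : EuclideanSpace ℝ (Fin 2)) 1 :=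
      fun b => ⟨r (cycChart k b), hmem b⟩
    have hf : Continuous f :=
      (r.continuous.comp continuous_cycChart).subtype_mk _
    have hbij : Function.Bijective f := by
      refine ⟨fun b b' h => cycChart_injective (r.injective (congrArg Subtype.val h)), ?_⟩
      rintro ⟨z, hz⟩
      obtain ⟨b, hb⟩ : r.symm z ∈ range (cycChart k) := by
        rw [range_cycChart, mem_closedBall_zero_iff, r.symm.norm_map]
        exact mem_closedBall_zero_iff.1 hz
      exact ⟨b, Subtype.ext (by simp only [f, hb, r.apply_symm_apply])⟩
    refine ⟨(Continuous.homeoOfEquivCompactToT2 (f := Equiv.ofBijective f hbij) hf), fun i p => ?_⟩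
    change r (cycChart k ((cyc k).cube i p)) ∈ _ ↔ _
    rw [mem_sphere_zero_iff_norm, r.norm_map, ← sqRadius_eq_one_iff]
    exact iff_of_eq (congrArg (· = 1) (norm_sectorMap k (ZMod.val i) p))

end Cyc

/-! ### The classification of left cubical balls -/

section Planar

open Set Metric

theorem injective_of_injOn_interior_of_chart {K : Type*} [TopologicalSpace K] [CompactSpace K]
    {a f : K → ℂ} (ha : Continuous a) (hai : Function.Injective a)
    (har : range a = closedBall 0 1) (hf : Continuous f) (hfr : range f = closedBall 0 1)
    (hS : ∀ z, ‖f z‖ = 1 ↔ ‖a z‖ = 1) (hinj : ∀ z z', ‖f z‖ < 1 → f z = f z' → z = z')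
    (hfin : ∀ w, (f ⁻¹' {w}).Finite) : Function.Injective f := by
  let h : closedBall (0 : ℂ) 1 ≃ₜ K :=
    (Homeomorph.setCongr har.symm).trans (ha.isClosedEmbedding hai).isEmbedding.toHomeomorph.symm
  have hah : ∀ z, a (h z) = z := fun z => by
    have := congrArg Subtype.val
      ((ha.isClosedEmbedding hai).isEmbedding.toHomeomorph.apply_symm_apply
        (Homeomorph.setCongr har.symm z))
    exact this
  have key := injective_of_injOn_interior (f ∘ h) (hf.comp h.continuous)
    (by rw [h.surjective.range_comp, hfr]) (fun z => by rw [Function.comp, hS, hah])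
    (fun z z' hz hzz' => h.injective (hinj _ _ hz hzz'))
    (fun w => by rw [Set.preimage_comp]; exact (hfin w).preimage h.injective.injOn)
  intro z z' hzz'
  obtain ⟨y, rfl⟩ := h.surjective z
  obtain ⟨y', rfl⟩ := h.surjective z'
  rw [key hzz']

end Planar

namespace CubicalData

open Set

variable {B : CubicalData.{u}}

namespace IsLeftCubicalBall

variable {k : ℕ} {e : ZMod k ≃ B.Cell} {s : ZMod k → Fin 2}

/-- A left cubical ball with a cyclic listing of its `k` squares is homeomorphic to `C_k`. -/
theorem exists_homeomorph_of_listing (hB : B.IsLeftCubicalBall) (hk : 2 ≤ k)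
    (hs : B.IsCyclicListing e s) : ∃ φ : (cyc k).carrier ≃ₜ B.carrier,
      (∀ (i : ZMod k) p, φ ((cyc k).cube i p) = B.page (e i, s i) p) ∧
        φ (cyc k).zero = B.zero := by
  have : NeZero k := ⟨by omega⟩
  have := hB.t2Space
  have hcyc := cyc_isLeftCubicalBall (k := k) hk
  obtain ⟨a, ha, hai, har, hab⟩ := hcyc.exists_chart
  obtain ⟨χ, hχ, hχi, hχr, hχb⟩ := hB.exists_chart
  let F : (cyc k).carrier → B.carrier :=
    Quot.lift (fun x : (_ : ZMod k) × (I × I) => B.page (e x.1, s x.1) x.2) (by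
      rintro _ _ ⟨i, t⟩
      simp only [page_zero_right, page_zero_left]
      rw [hs i])
  have hF : Continuous F := continuous_quot_lift _
    (continuous_sigma fun i => (B.page (e i, s i)).continuous)
  have hFc : ∀ (i : ZMod k) p, F ((cyc k).cube i p) = B.page (e i, s i) p := fun _ _ => rfl
  have hFs : Function.Surjective F := by
    intro b
    obtain ⟨j, p, rfl⟩ := hB.cover b
    obtain ⟨i, rfl⟩ := e.surjective j
    rcases B.cube_eq_page (e i) (s i) p with h | h <;> rw [h]
    exacts [⟨(cyc k).cube i p, rfl⟩, ⟨(cyc k).cube i p.swap, rfl⟩]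
  have hbd : ∀ (x : B.Cell × Fin 2) p, ‖χ (B.page x p)‖ = 1 ↔ p.1 = 1 ∨ p.2 = 1 := by
    intro x p
    rcases B.page_eq_cube x with h | h <;> rw [h, hχb]
    simp [or_comm]
  -- Over the interior, common edges determine all coincidences. On the boundary the planar lemma
  -- takes over; it needs finite fibres, and each square contributes at most one point to a fibre.
  have hFi : Function.Injective (χ ∘ F) := by
    refine injective_of_injOn_interior_of_chart ha hai har (hχ.comp hF)
      (by rw [hFs.range_comp, hχr]) ?_ ?_ ?_
    · intro b
      obtain ⟨i, p, rfl⟩ := cyc_cover b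
      rw [Function.comp, hFc, hbd, ← hab i p]
    · intro b b' hb hbb'
      obtain ⟨i, p, rfl⟩ := cyc_cover b
      obtain ⟨j, q, rfl⟩ := cyc_cover b'
      have hp := mt (hbd (e i, s i) p).2 hb.ne
      push Not at hp
      have h : B.page (e i, s i) p = B.page (e j, s j) q := hχi hbb'
      by_cases hij : i = j
      · subst hij
        rw [hB.page_injective _ h]
      rw [cyc_cube_eq_iff]
      by_cases hp0 : p = (0, 0)
      · refine Or.inr (Or.inl ⟨hp0, ?_⟩)
        rw [hp0, hB.page_origin, ← hB.page_origin (e j, s j)] at h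
        exact (hB.page_injective _ h).symm
      obtain ⟨c, d, t, rfl, rfl, he⟩ := hB.page_exists_common_edge
        (show e i ≠ e j from fun h => hij (e.injective h)) h hp.1 hp.2 hp0
      have h1 : ∀ a b : Fin 2, a + b = a + 1 → b = 1 := by decide
      have h0 : ∀ a b : Fin 2, a + b = a → b = 0 := by decide
      rcases (hB.edge_eq_iff_of_listing hs).1 he with ⟨h, -⟩ | ⟨h, hc, hd⟩ | ⟨h, hc, hd⟩
      · exact absurd h hij
      · rw [h1 _ _ hc, h0 _ _ hd]
        exact Or.inr (Or.inr (Or.inl ⟨h, t, rfl, rfl⟩))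
      · rw [h0 _ _ hc, h1 _ _ hd]
        exact Or.inr (Or.inr (Or.inr ⟨h, t, rfl, rfl⟩))
    · intro w
      refine (Set.finite_iUnion (f := fun i : ZMod k =>
        (cyc k).cube i '' {p | χ (B.page (e i, s i) p) = w}) fun i => ?_).subset ?_
      · refine (Set.Subsingleton.finite fun p hp q hq => ?_).image _
        exact hB.page_injective (e i, s i) (hχi (hp.trans hq.symm))
      · intro b hb
        obtain ⟨i, p, rfl⟩ := cyc_cover b
        exact mem_iUnion.2 ⟨i, p, hb, rfl⟩
  let φ := Continuous.homeoOfEquivCompactToT2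
    (f := Equiv.ofBijective F ⟨hFi.of_comp, hFs⟩) hF
  refine ⟨φ, hFc, ?_⟩
  rw [← cyc_cube_zero 0]
  exact (hFc 0 _).trans (hB.page_origin _)

theorem equivalent_cyc_of_listing (hB : B.IsLeftCubicalBall) (hk : 2 ≤ k)
    (hs : B.IsCyclicListing e s) : B.Equivalent (cyc k) := by
  obtain ⟨φ, hφ, hφ0⟩ := hB.exists_homeomorph_of_listing hk hs
  have key : ∀ i : ZMod k, (∀ p, φ.symm (B.cube (e i) p) = (cyc k).cube i p) ∨
      ∀ p, φ.symm (B.cube (e i) p) = (cyc k).cube i p.swap := by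
    intro i
    refine (B.page_eq_cube (e i, s i)).imp (fun h p => ?_) fun h p => ?_
    · rw [φ.symm_apply_eq, hφ, h]
    · rw [φ.symm_apply_eq, hφ, h, Prod.swap_swap]
  refine ⟨φ.symm, e.symm, by rw [← hφ0, φ.symm_apply_apply], fun c => ?_⟩
  have h := key (e.symm c)
  rw [e.apply_symm_apply] at h
  exact h

/-- Being a left cubical ball is invariant under equivalence. -/
theorem of_equivalent {B' : CubicalData.{v}} (hB : B.IsLeftCubicalBall) (h : B.Equivalent B') :
    B'.IsLeftCubicalBall := by
  obtain ⟨φ, τ, h0, hc⟩ := h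
  have hf : ∀ i, ∃ f : Fin 2, ∀ p, B'.cube (τ i) p = φ (B.page (i, f) p) := fun i =>
    (hc i).elim (fun h => ⟨0, fun p => (h p).symm⟩)
      fun h => ⟨1, fun p => by rw [page_one, h, Prod.swap_swap]⟩
  choose f hf using hf
  have hface : ∀ i a b, ∃ a' b', B'.cube (τ i) '' openFace a b =
      φ '' (B.cube i '' openFace a' b') := by
    intro i a b
    rcases B.page_eq_cube (i, f i) with h | h
    · refine ⟨a, b, ?_⟩
      rw [image_image]
      exact image_congr fun p _ => by rw [hf, h]
    · refine ⟨b, a, ?_⟩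
      rw [openFace, openFace, ← image_swap_prod, image_image, image_image]
      exact image_congr fun p _ => by rw [hf, h, Prod.swap_swap]
  -- `hface` does not record which face is obtained; the open square is symmetric under the swap.
  have hsq : ∀ i, B'.cube (τ i) '' openFace 1 1 = φ '' (B.cube i '' openFace 1 1) := by
    intro i
    rcases B.page_eq_cube (i, f i) with h | h
    · rw [image_image]
      exact image_congr fun p _ => by rw [hf, h]
    · conv_rhs => rw [openFace, ← image_swap_prod, image_image, image_image]
      exact image_congr fun p _ => by rw [hf, h]
  have hedge : ∀ i s, B'.edge (τ i) s = (φ : C(B.carrier, B'.carrier)).comp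
      (B.edge i (f i + s)) := fun i s => ContinuousMap.ext fun t =>
    (hf i _).trans (congrArg φ (page_faceIncl (i, f i) s t))
  refine ⟨?_, ?_, ?_, ?_, ?_, ?_, ?_, ?_⟩
  · have := hB.finite
    exact Finite.of_equiv _ τ
  · intro j p q hpq
    obtain ⟨i, rfl⟩ := τ.surjective j
    rw [hf, hf] at hpq
    exact hB.page_injective _ (φ.injective hpq)
  · intro b
    obtain ⟨i, p, hp⟩ := hB.cover (φ.symm b)
    rcases B.cube_eq_page i (f i) p with h | h
    · exact ⟨τ i, p, by rw [hf, ← h, hp, φ.apply_symm_apply]⟩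
    · exact ⟨τ i, p.swap, by rw [hf, ← h, hp, φ.apply_symm_apply]⟩
  · intro j j' hjj'
    obtain ⟨i, rfl⟩ := τ.surjective j
    obtain ⟨i', rfl⟩ := τ.surjective j'
    rw [hsq, hsq, disjoint_image_iff φ.injective]
    exact hB.cells_distinct i i' fun h => hjj' (by rw [h])
  · intro j j' a b c d
    obtain ⟨i, rfl⟩ := τ.surjective j
    obtain ⟨i', rfl⟩ := τ.surjective j'
    obtain ⟨a', b', h⟩ := hface i a b
    obtain ⟨c', d', h'⟩ := hface i' c d
    rw [h, h', disjoint_image_iff φ.injective, φ.injective.image_injective.eq_iff]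
    exact hB.cells_partition i i' a' b' c' d'
  · intro j j' s t h
    obtain ⟨i, rfl⟩ := τ.surjective j
    obtain ⟨i', rfl⟩ := τ.surjective j'
    have hr : ∀ i s, range (B'.edge (τ i) s) = φ '' range (B.edge i (f i + s)) := fun i s => by
      rw [hedge, ← range_comp]; rfl
    rw [hr, hr, φ.injective.image_injective.eq_iff] at h
    rw [hedge, hedge, hB.edge_compatible _ _ _ _ h]
  · intro j
    obtain ⟨i, rfl⟩ := τ.surjective j
    rw [hf, hB.page_origin, h0]
  · obtain ⟨χ, hχ⟩ := hB.disk
    refine ⟨φ.symm.trans χ, fun j p => ?_⟩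
    obtain ⟨i, rfl⟩ := τ.surjective j
    rw [hf, Homeomorph.trans_apply, φ.symm_apply_apply]
    rcases B.page_eq_cube (i, f i) with h | h <;> rw [h, hχ]
    simp [or_comm]

end IsLeftCubicalBall
end CubicalData

/-! ### Left 2-cubical balls and circular chains -/

section Chains

variable {X : Type w} [TopologicalSpace X] {x₀ : X}

theorem LeftTrack.face_inv (α : LeftTrack x₀) (s : Fin 2) : α.inv.face s = α.face (s + 1) := by
  induction α using Quotient.inductionOn with
  | h α => fin_cases s <;> rfl

theorem tgtFace_eq (ε : ℤˣ) : tgtFace ε = srcFace ε + 1 := by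
  rcases Int.units_eq_one_or ε with rfl | rfl <;> rfl

theorem LeftTrack.src_signed (α : LeftTrack x₀) (ε : ℤˣ) :
    (α.signed ε).src = α.face (srcFace ε) := by
  rcases Int.units_eq_one_or ε with rfl | rfl
  · rfl
  · exact α.face_inv 0

theorem LeftTrack.tgt_signed (α : LeftTrack x₀) (ε : ℤˣ) :
    (α.signed ε).tgt = α.face (tgtFace ε) := by
  rcases Int.units_eq_one_or ε with rfl | rfl
  · rfl
  · exact α.face_inv 1

/-- Translates between source and target faces and the signed incidence numbers that define
orientations. -/
theorem eq_srcFace_iff {ε : ℤˣ} {s : Fin 2} :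
    s = srcFace ε ↔ ε * CubicalData.faceSign s = -1 := by
  rcases Int.units_eq_one_or ε with rfl | rfl <;> fin_cases s <;> decide

theorem eq_tgtFace_iff {ε : ℤˣ} {s : Fin 2} :
    s = tgtFace ε ↔ ε * CubicalData.faceSign s = 1 := by
  rcases Int.units_eq_one_or ε with rfl | rfl <;> fin_cases s <;> decide

theorem CircularChain.neZero (c : CircularChain x₀) : NeZero c.length :=
  ⟨by have := c.two_le; omega⟩

/-- A listing that enters one square through its source face enters all of them so, because the
orientation keeps the signed incidence number of the entry face constant. -/
theorem Left2CubicalBall.exists_expresses (β : Left2CubicalBall.{u} x₀) :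
    ∃ c : CircularChain x₀, c.Expresses β := by
  obtain ⟨i₀⟩ := β.isBall.cells_nonempty
  obtain ⟨k, hk, e, s, hs, he0, hs0⟩ :=
    β.isBall.exists_cyclicListing (i₀, srcFace (β.sign i₀))
  have : NeZero k := ⟨by omega⟩
  have hsrc : ∀ i, s i = srcFace (β.sign (e i)) := fun i => by
    rw [eq_srcFace_iff, (β.isBall.isOrientation_iff_of_listing hs _).1 β.isOrientation,
      ← eq_srcFace_iff, hs0, he0]
  have hedge : ∀ i, β.edge (e i) (tgtFace (β.sign (e i))) =
      β.edge (e (i + 1)) (srcFace (β.sign (e (i + 1)))) := fun i => by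
    rw [tgtFace_eq, ← hsrc, ← hsrc]
    exact hs i
  exact ⟨⟨k, hk, fun i => β.track (e i), fun i => β.sign (e i), fun i => by
    rw [LeftTrack.tgt_signed, LeftTrack.src_signed]
    exact β.glue _ _ _ _ (hedge i)⟩, e, fun _ => rfl, fun _ => rfl, hedge⟩

namespace CircularChain

/-- The squares of `C_k`, with the coordinates of the squares of negative sign swapped. -/
def ballData (c : CircularChain x₀) : CubicalData.{u} where
  carrier := ULift.{u} (cyc c.length).carrier
  Cell := ZMod c.length
  cube i := ⟨fun p => ULift.up ((cyc c.length).page (i, srcFace (c.sign i)) p), by fun_prop⟩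
  zero := ULift.up (cyc c.length).zero

theorem ballData_isLeftCubicalBall (c : CircularChain x₀) :
    (ballData.{u} c).IsLeftCubicalBall := by
  have := c.neZero
  refine (cyc_isLeftCubicalBall c.two_le).of_equivalent
    ⟨Homeomorph.ulift.symm, Equiv.refl _, rfl, fun i => ?_⟩
  refine ((cyc c.length).page_eq_cube (i, srcFace (c.sign i))).imp (fun h p => ?_) fun h p => ?_
  · exact congrArg ULift.up (h p).symm
  · exact congrArg ULift.up (h p.swap).symm

/-- The swaps shift face indices by `srcFace`, so the faces `∂⁰₁` and `∂⁰₂` of the squares of `C_k`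
become the source and target faces. -/
theorem ballData_edge_eq_iff (c : CircularChain x₀) {i j : ZMod c.length} {s t : Fin 2} :
    (ballData.{u} c).edge i s = (ballData.{u} c).edge j t ↔
      (i = j ∧ s = t) ∨ (j = i + 1 ∧ s = tgtFace (c.sign i) ∧ t = srcFace (c.sign j)) ∨
        (i = j + 1 ∧ s = srcFace (c.sign i) ∧ t = tgtFace (c.sign j)) := by
  have := c.neZero
  have hedge : ∀ (i : ZMod c.length) s t, (ballData.{u} c).edge i s t =
      ULift.up ((cyc c.length).edge i (srcFace (c.sign i) + s) t) := fun i s t =>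
    congrArg ULift.up (CubicalData.IsLeftCubicalBall.page_faceIncl (B := cyc c.length)
      (i, srcFace (c.sign i)) s t)
  have h : (ballData.{u} c).edge i s = (ballData.{u} c).edge j t ↔
      (cyc c.length).edge i (srcFace (c.sign i) + s) =
        (cyc c.length).edge j (srcFace (c.sign j) + t) := by
    simp only [DFunLike.ext_iff, hedge]
    exact forall_congr' fun _ => ULift.up_inj
  rw [h, cyc_edge_eq_iff, tgtFace_eq, tgtFace_eq]
  have h1 : ∀ a b : Fin 2, a + b = 1 ↔ b = a + 1 := by decide
  have h0 : ∀ a b : Fin 2, a + b = 0 ↔ b = a := by decide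
  rw [h1, h0, h1, h0]
  refine or_congr_left (and_congr_right ?_)
  rintro rfl
  exact add_right_inj _

/-- The left 2-cubical ball glued from a circular chain. -/
def ball (c : CircularChain x₀) : Left2CubicalBall.{u} x₀ where
  toCubicalData := ballData.{u} c
  isBall := c.ballData_isLeftCubicalBall
  sign := c.sign
  isOrientation i j s t hne h := by
    rcases c.ballData_edge_eq_iff.1 h with ⟨rfl, rfl⟩ | ⟨-, hs, ht⟩ | ⟨-, hs, ht⟩
    · exact absurd rfl hne
    · rw [eq_tgtFace_iff.1 hs, eq_srcFace_iff.1 ht, neg_neg]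
    · rw [eq_srcFace_iff.1 hs, eq_tgtFace_iff.1 ht]
  track := c.track
  glue i j s t h := by
    have hc := c.composable
    simp only [LeftTrack.tgt_signed, LeftTrack.src_signed] at hc
    rcases c.ballData_edge_eq_iff.1 h with ⟨rfl, rfl⟩ | ⟨rfl, rfl, rfl⟩ | ⟨rfl, rfl, rfl⟩
    exacts [rfl, hc i, (hc j).symm]

theorem expresses_ball (c : CircularChain x₀) : c.Expresses (ball.{u} c) :=
  ⟨Equiv.refl _, fun _ => rfl, fun _ => rfl, fun _ =>
    c.ballData_edge_eq_iff.2 (Or.inr (Or.inl ⟨rfl, rfl, rfl⟩))⟩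

theorem expresses_of_cyclicPerm {β : Left2CubicalBall.{u} x₀} {c c' : CircularChain x₀}
    (h : c.Expresses β) (hcc' : c.CyclicPerm c') : c'.Expresses β := by
  obtain ⟨e, het, hes, hee⟩ := h
  obtain ⟨k, hk, t, s, hc⟩ := c
  obtain ⟨k', hk', t', s', hc'⟩ := c'
  obtain ⟨hkk', m, hm⟩ := hcc'
  obtain rfl : k' = k := hkk'
  refine ⟨(Equiv.addRight (m : ZMod k')).trans e, fun i => ?_, fun i => ?_, fun i => ?_⟩
  · obtain ⟨i, rfl⟩ := ZMod.intCast_surjective i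
    refine (hm i).1.trans ((congrArg t ?_).trans (het _))
    simp
  · obtain ⟨i, rfl⟩ := ZMod.intCast_surjective i
    refine (hm i).2.trans ((congrArg s ?_).trans (hes _))
    simp
  · have := hee (i + m)
    rw [add_right_comm] at this
    exact this

theorem Expresses.isCyclicListing {β : Left2CubicalBall.{u} x₀} {c : CircularChain x₀}
    {e : ZMod c.length ≃ β.Cell}
    (h : ∀ i, β.edge (e i) (tgtFace (β.sign (e i))) =
      β.edge (e (i + 1)) (srcFace (β.sign (e (i + 1))))) :
    β.IsCyclicListing e fun i => srcFace (β.sign (e i)) := fun i => by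
  rw [← tgtFace_eq]
  exact h i

/-- Comparing the two listings gives a map of `ZMod k` that commutes with `+ 1`, hence a
translation. Reversal is impossible because both listings leave each square through its target face.
-/
theorem Expresses.cyclicPerm {β : Left2CubicalBall.{u} x₀} {c c' : CircularChain x₀}
    (h : c.Expresses β) (h' : c'.Expresses β) : c.CyclicPerm c' := by
  have := c.neZero
  obtain ⟨e, het, hes, hee⟩ := h
  obtain ⟨e', het', hes', hee'⟩ := h'
  have hcard : c'.length = c.length := by
    have := Nat.card_congr (e'.trans e.symm)
    simpa using this
  obtain ⟨k, hk, t, s, hc⟩ := c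
  obtain ⟨k', hk', t', s', hc'⟩ := c'
  obtain rfl : k' = k := hcard
  dsimp only at *
  have hl := Expresses.isCyclicListing (c := ⟨k', hk, t, s, hc⟩) hee
  set f : ZMod k' → ZMod k' := fun i => e.symm (e' i) with hf
  have hef : ∀ i, e (f i) = e' i := fun i => e.apply_symm_apply _
  have hstep : ∀ i, f (i + 1) = f i + 1 := by
    intro i
    have h := hee' i
    rw [← hef, ← hef, tgtFace_eq] at h
    rcases (β.isBall.edge_eq_iff_of_listing hl).1 h with ⟨h1, h2⟩ | ⟨h1, -⟩ | ⟨-, h2, -⟩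
    · rw [← h1] at h2
      exact absurd h2 (fin_two_add_one_ne _)
    · exact h1
    · exact absurd h2 (fin_two_add_one_ne _)
  have hconst := zmod_eq_of_apply_add_one (f := fun i => f i - i) fun i => by
    rw [hstep]; ring
  obtain ⟨m, hm⟩ := ZMod.intCast_surjective (f 0)
  have hfm : ∀ i : ℤ, e' (i : ZMod k') = e ((i + m : ℤ) : ZMod k') := fun i => by
    rw [← hef]
    congr 1
    have := hconst i
    push_cast
    rw [hm]
    linear_combination this
  exact ⟨rfl, m, fun i => ⟨(het' _).trans ((congrArg β.track (hfm i)).trans (het _).symm),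
    (hes' _).trans ((congrArg β.sign (hfm i)).trans (hes _).symm)⟩⟩

theorem Expresses.of_equivalent {β : Left2CubicalBall.{u} x₀} {β' : Left2CubicalBall.{v} x₀}
    {c : CircularChain x₀} (h : c.Expresses β) (hββ' : β.Equivalent β') : c.Expresses β' := by
  obtain ⟨e, het, hes, hee⟩ := h
  obtain ⟨φ, τ, -, hφ, hτs, hτt⟩ := hββ'
  have hedge : ∀ i s t, β'.edge (τ i) s t = φ (β.edge i s t) := fun i s t => (hφ i _).symm
  refine ⟨e.trans τ, fun i => (het i).trans (hτt _).symm, fun i => (hes i).trans (hτs _).symm,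
    fun i => ?_⟩
  ext t
  simp only [Equiv.trans_apply, hτs, hedge, hee i]

/-- Both balls are homeomorphic to the same `C_k`. Corresponding squares have equal signs, so the
coordinate swaps on the two sides agree and the composite preserves the parametrizations exactly. -/
theorem Expresses.equivalent {β : Left2CubicalBall.{u} x₀} {β' : Left2CubicalBall.{v} x₀}
    {c : CircularChain x₀} (h : c.Expresses β) (h' : c.Expresses β') : β.Equivalent β' := by
  obtain ⟨e, het, hes, hee⟩ := h
  obtain ⟨e', het', hes', hee'⟩ := h'
  obtain ⟨φ, hφ, hφ0⟩ := β.isBall.exists_homeomorph_of_listing c.two_le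
    (Expresses.isCyclicListing hee)
  obtain ⟨φ', hφ', hφ0'⟩ := β'.isBall.exists_homeomorph_of_listing c.two_le
    (Expresses.isCyclicListing hee')
  refine ⟨φ.symm.trans φ', e.symm.trans e', ?_, ?_, ?_, ?_⟩
  · rw [← hφ0, Homeomorph.trans_apply, φ.symm_apply_apply, hφ0']
  all_goals
    intro i
    obtain ⟨i, rfl⟩ := e.surjective i
    simp only [Equiv.trans_apply, e.symm_apply_apply]
  · intro p
    have hpage : ∀ q, φ' (φ.symm (β.page (e i, srcFace (β.sign (e i))) q)) =
        β'.page (e' i, srcFace (β'.sign (e' i))) q := fun q => by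
      rw [← hφ, φ.symm_apply_apply, hφ']
    rw [← hes, ← hes'] at hpage
    generalize srcFace (c.sign i) = s at hpage
    fin_cases s
    · exact hpage p
    · exact hpage p.swap
  · rw [← hes, ← hes']
  · rw [← het, ← het']

end CircularChain
end Chains
end LeftCubical

theorem mainTheorem9 :
    (∀ k : ℕ, 2 ≤ k → (LeftCubical.cyc k).IsLeftCubicalBall ∧
      ∀ (i j : ZMod k) (s t : Fin 2),
        (LeftCubical.cyc k).edge i s = (LeftCubical.cyc k).edge j t ↔
          (i = j ∧ s = t) ∨ (j = i + 1 ∧ s = 1 ∧ t = 0) ∨ (i = j + 1 ∧ s = 0 ∧ t = 1)) ∧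
    (∀ B : LeftCubical.CubicalData.{u}, B.IsLeftCubicalBall →
      (∃ k : ℕ, 2 ≤ k ∧ B.Equivalent (LeftCubical.cyc k)) ∧
      ∃ ε : B.Cell → ℤˣ, ∀ ε' : B.Cell → ℤˣ, B.IsOrientation ε' ↔ ε' = ε ∨ ε' = -ε) ∧
    (∀ (X : Type w) [TopologicalSpace X] (x₀ : X),
      (∀ β : LeftCubical.Left2CubicalBall.{u} x₀,
        ∃ c : LeftCubical.CircularChain x₀, c.Expresses β) ∧
      (∀ c : LeftCubical.CircularChain x₀,
        ∃ β : LeftCubical.Left2CubicalBall.{u} x₀, c.Expresses β) ∧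
      (∀ (β : LeftCubical.Left2CubicalBall.{u} x₀) (c c' : LeftCubical.CircularChain x₀),
        c.Expresses β → (c'.Expresses β ↔ c.CyclicPerm c')) ∧
      (∀ (β : LeftCubical.Left2CubicalBall.{u} x₀) (β' : LeftCubical.Left2CubicalBall.{v} x₀)
        (c : LeftCubical.CircularChain x₀),
        c.Expresses β → (c.Expresses β' ↔ β.Equivalent β'))) := by
  refine ⟨fun k hk => ?_, fun B hB => ?_, fun X _ x₀ => ⟨fun β => β.exists_expresses,
    fun c => ⟨c.ball, c.expresses_ball⟩,
    fun β c c' h => ⟨h.cyclicPerm, fun h' => LeftCubical.CircularChain.expresses_of_cyclicPerm h h'⟩,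
    fun β β' c h => ⟨h.equivalent, h.of_equivalent⟩⟩⟩
  · have : NeZero k := ⟨by omega⟩
    exact ⟨LeftCubical.cyc_isLeftCubicalBall hk, fun i j s t => LeftCubical.cyc_edge_eq_iff⟩
  · obtain ⟨i⟩ := hB.cells_nonempty
    obtain ⟨k, hk, e, s, hs, -⟩ := hB.exists_cyclicListing (i, 0)
    have : NeZero k := ⟨by omega⟩
    exact ⟨⟨k, hk, hB.equivalent_cyc_of_listing hk hs⟩, hB.exists_orientation_of_listing hs⟩
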